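/- Let $E$ be a Dedekind complete $\Phi$-algebra, i.e. a Dedekind complete real vector lattice with an associative bilinear multiplication with unit such that $xy\ge 0$ for $x,y\ge 0$, and $x\wedge y=0$, $z\ge 0$ imply $(xz)\wedge y=(zx)\wedge y=0$. Write $a\ll b$ if $b-a$ is a weak order unit of $E$ (that is, $b-a\ge 0$, and $|x|\wedge(b-a)=0$ implies $x=0$), $[a,b]=\{x: a\le x\le b\}$ and $(a,b)=\{x: a\ll x\ll b\}$. Write $\Delta\downarrow 0$ if $\Delta\subseteq E$ is nonempty, downwards directed and has infimum $0$, and $\mathcal E\searrow 0$ if $\mathcal E\subseteq E$ has infimum $0$. A net $(x_\alpha)$ converges in order to $x$, written $x_\alpha\to x$, if there is $\mathcal E\searrow 0$ such that for every $\varepsilon\in\mathcal E$ there is $\alpha_0$ with $|x_\alpha-x|\le\varepsilon$ for all $\alpha\ge\alpha_0$. Let $h\colon[a,b]\to E$. * $h$ is *locally band preserving* if for every band projection $\mathbb P$ of $E$ and all $x,y\in[a,b]$, $\mathbb P x=\mathbb P y$ implies $\mathbb P h(x)=\mathbb P h(y)$. * $h$ is *order continuous* if, for every $c\in[a,b]$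 and every net $(x_\alpha)$ in $[a,b]$, $x_\alpha\to c$ implies $h(x_\alpha)\to h(c)$. * $h$ is *order differentiable at $c$ with order derivative $d\in E$* if there is a weak order unit $r$ with $(c-r,c+r)\subseteq[a,b]$ such that for every $\Delta\downarrow0$ there is $\mathcal E\searrow0$ such that for every $\varepsilon\in\mathcal E$ there is $\delta\in\Delta$ with $|h(x)-h(c)-(x-c)d|\le|x-c|\,\varepsilon$ whenever $x\in(c-r,c+r)$ and $|x-c|\le\delta$. * $h$ is *integrable* if it is order bounded and $\sup_P L(h,P)=\inf_P U(h,P)$, where $P$ runs over all partitions $a=x_0\le x_1\le\dots\le x_n=b$, $L(h,P)=\sum_{i=1}^n\big(\inf_{[x_{i-1},x_i]}h\big)(x_i-x_{i-1})$ and $U(h,P)=\sum_{i=1}^n\big(\sup_{[x_{i-1},x_i]}h\big)(x_i-x_{i-1})$; the common value is $\int_a^b h(x)\,dx$. **Proposition (integration by parts).** Suppose $a\ll b$. Let $f,g,f',g'\colon[a,b]\to E$ be locally band preserving, order continuous on $[a,b]$ and integrable, and suppose that for every $c\in(a,b)$ the functions $f$ and $g$ are order differentiable at $c$ with order derivatives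 $f'(c)$ and $g'(c)$, respectively. Then $fg'$ and $f'g$ are integrable on $[a,b]$ and $$\int_a^b f(x)g'(x)\,dx=f(b)g(b)-f(a)g(a)-\int_a^b f'(x)g(x)\,dx.$$ -/

import Mathlib

universe u

noncomputable section

namespace OrderCalculus

/-- The lattice-theoretic axioms of an `f`-algebra: products of positive elements are positive, and
multiplication by positive elements preserves disjointness. Together with `[Ring E]`,
`[ConditionallyCompleteLattice E]`, `[IsOrderedAddMonoid E]`, `[Algebra ℝ E]` and `[PosSMulMono ℝ E]`
it says that `E` is a Dedekind complete unital `f`-algebra, i.e. a Dedekind complete `Φ`-algebra.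
(Commutativity and `0 ≤ 1` are consequences and are not assumed.) -/
class IsFAlgebra (E : Type u) [Ring E] [Lattice E] : Prop where
  mul_nonneg : ∀ x y : E, 0 ≤ x → 0 ≤ y → 0 ≤ x * y
  mul_inf_eq_zero : ∀ x y z : E, x ⊓ y = 0 → 0 ≤ z → (x * z) ⊓ y = 0
  mul_inf_eq_zero' : ∀ x y z : E, x ⊓ y = 0 → 0 ≤ z → (z * x) ⊓ y = 0

section Lattice

variable {E : Type u} [Ring E] [Lattice E]

/-- `u` is a weak order unit: `u ≥ 0` and only `0` is disjoint from `u`. -/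
def IsWeakOrderUnit (u : E) : Prop :=
  0 ≤ u ∧ ∀ x : E, |x| ⊓ u = 0 → x = 0

/-- The relation `a ≪ b`. -/
def WayLT (a b : E) : Prop :=
  IsWeakOrderUnit (b - a)

/-- The open order interval `(a, b) = {x | a ≪ x ≪ b}`. -/
def openInterval (a b : E) : Set E :=
  {x | WayLT a x ∧ WayLT x b}

/-- `Δ ↓ 0`: a (nonempty) downwards directed set with infimum `0`. -/
def DecreasesToZero (Δ : Set E) : Prop :=
  Δ.Nonempty ∧ DirectedOn (· ≥ ·) Δ ∧ IsGLB Δ 0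

/-- Order convergence of a net. -/
def OrderTendsto {ι : Type u} [Preorder ι] (x : ι → E) (l : E) : Prop :=
  ∃ Eps : Set E, IsGLB Eps 0 ∧ ∀ ε ∈ Eps, ∃ α₀ : ι, ∀ α, α₀ ≤ α → |x α - l| ≤ ε

/-- Order continuity (at every point of `s`) of the restriction of `f` to `s`, through nets in `s`. -/
def OrderContinuousOn (f : E → E) (s : Set E) : Prop :=
  ∀ c ∈ s, ∀ (ι : Type u) [Preorder ι] [Nonempty ι] [IsDirected ι (· ≤ ·)] (x : ι → E),
    (∀ α, x α ∈ s) → OrderTendsto x c → OrderTendsto (fun α => f (x α)) (f c)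

/-- The restriction of `f` to `s` is order differentiable at `c` with derivative `d`. -/
def HasOrderDerivAt (f : E → E) (s : Set E) (d c : E) : Prop :=
  ∃ r : E, WayLT 0 r ∧ openInterval (c - r) (c + r) ⊆ s ∧
    ∀ Δ : Set E, DecreasesToZero Δ → ∃ Eps : Set E, IsGLB Eps 0 ∧ ∀ ε ∈ Eps, ∃ δ ∈ Δ,
      ∀ x ∈ openInterval (c - r) (c + r), |x - c| ≤ δ →
        |f x - f c - (x - c) * d| ≤ |x - c| * ε

/-- The image of `s` under `f` is contained in an order interval. -/
def OrderBoundedOn (f : E → E) (s : Set E) : Prop :=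
  BddBelow (f '' s) ∧ BddAbove (f '' s)

variable [Algebra ℝ E]

/-- A band: a solid subspace that contains every supremum in `E` of one of its subsets. -/
def IsBand (B : Submodule ℝ E) : Prop :=
  (∀ x ∈ B, ∀ y : E, |y| ≤ |x| → y ∈ B) ∧
    ∀ S : Set E, S ⊆ B → ∀ x : E, IsLUB S x → x ∈ B

/-- A band projection: the projection onto a band `B` along its disjoint complement. -/
def IsBandProjection (P : E →ₗ[ℝ] E) : Prop :=
  ∃ B : Submodule ℝ E, IsBand B ∧
    ∀ x : E, P x ∈ B ∧ ∀ y ∈ B, |x - P x| ⊓ |y| = 0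

/-- The restriction of `f` to `s` is locally band preserving. -/
def LocallyBandPreservingOn (f : E → E) (s : Set E) : Prop :=
  ∀ P : E →ₗ[ℝ] E, IsBandProjection P → ∀ x ∈ s, ∀ y ∈ s, P x = P y → P (f x) = P (f y)

end Lattice

/-- A partition `a = x₀ ≤ x₁ ≤ ⋯ ≤ xₙ = b` of `[a, b]`; only `pts i` with `i ≤ n` matters. -/
structure Partition {E : Type u} [Preorder E] (a b : E) where
  n : ℕ
  pts : ℕ → E
  pts_zero : pts 0 = a
  pts_last : pts n = b
  le_succ : ∀ i < n, pts i ≤ pts (i + 1)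

section Integral

variable {E : Type u} [Ring E] [ConditionallyCompleteLattice E]

/-- The lower Darboux sum `L(f, P)`. -/
def lowerSum (f : E → E) {a b : E} (P : Partition a b) : E :=
  ∑ i ∈ Finset.range P.n,
    sInf (f '' Set.Icc (P.pts i) (P.pts (i + 1))) * (P.pts (i + 1) - P.pts i)

/-- The upper Darboux sum `U(f, P)`. -/
def upperSum (f : E → E) {a b : E} (P : Partition a b) : E :=
  ∑ i ∈ Finset.range P.n,
    sSup (f '' Set.Icc (P.pts i) (P.pts (i + 1))) * (P.pts (i + 1) - P.pts i)

/-- The lower integral `L(f)` over `[a, b]`. -/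
def lowerIntegral (f : E → E) (a b : E) : E :=
  sSup (Set.range fun P : Partition a b => lowerSum f P)

/-- The upper integral `U(f)` over `[a, b]`. -/
def upperIntegral (f : E → E) (a b : E) : E :=
  sInf (Set.range fun P : Partition a b => upperSum f P)

/-- `f` is order bounded and Darboux integrable on `[a, b]` (for `a ≤ b`). -/
def DarbouxIntegrable (f : E → E) (a b : E) : Prop :=
  OrderBoundedOn f (Set.Icc a b) ∧ upperIntegral f a b = lowerIntegral f a b

/-- The integral of `f` over `[a, b]`: the common value of the upper and lower integrals, meaningful
when `a ≤ b` and `f` is integrable. -/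
def darbouxIntegral (f : E → E) (a b : E) : E :=
  upperIntegral f a b

end Integral

end OrderCalculus

end

/-!
The proof follows the classical one: the product rule makes `f' g + f g'` a derivative of `f g`, and
the fundamental theorem of calculus identifies the sum of the two integrals with the increment
of `f g`. The work lies in replacing the linear order of `ℝ`.

*Localization.* A Dedekind complete unital `f`-algebra is commutative (`mul_comm_of_isFAlgebra`) and
reduced, and its band projections are the multiplications by idempotents
(`isBandProjection_mulLeft`, `IsBandProjection.exists_eq_mul`). Every `u ≥ 0` has a carrier
idempotent (`exists_carrier`), so any two elements are comparable on complementary bands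
(`exists_idempotent_mul_le`). For a locally band preserving function, points may be glued along an
idempotent `p` as `p x + (1 - p) y`, and the values are glued in the same way; this stands in for
case distinctions on real numbers.

*Common refinements.* Two chains of points need not lie in a common chain. Subdividing each interval
of `P` by the points of `Q`, truncated to that interval, gives a refinement of `P`. It does the
same job for `Q`: a piece `[u, v]` contributes only on the carrier of `v - u`, and there it lies in
an interval of `Q` (`exists_carrier_clampPt`, `exists_refinement`). Hence lower sums are bounded by
upper sums, integrability means that the infimum of `U(f, P) - L(f, P)` is `0`, and products of
integrable functions are integrable (`DarbouxIntegrable.mul`).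

*Mean value inequality.* If `f' ≤ M` on `[x, y]`, then `f y - f x ≤ (y - x) M`
(`sub_le_mul_of_hasOrderDerivAt`). When `[x, y]` lies inside `(a, b)`, it is bisected repeatedly,
the half with the larger defect being selected separately on each of two complementary bands; the
intervals shrink to a point `c`, where differentiability bounds the defect
(`HasOrderDerivAt.nonpos_of_forall_le`). The general case follows from order continuity. Scalars
`2⁻ⁿ` suffice for all limiting arguments. Summing over a partition bounds the increment of `f g` by
sums of upper (and, after a change of sign, lower) Darboux sums of `f g'` and `f' g`, and common
refinements pass from there to the integrals.
-/

set_option linter.unusedSectionVars false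

noncomputable section

namespace OrderCalculus

/-! ### Commutativity -/

section Ring

variable {E : Type u} [Ring E] [Lattice E] [IsOrderedAddMonoid E] [IsFAlgebra E]

theorem mul_eq_zero_of_inf_eq_zero {x y : E} (h : x ⊓ y = 0) : x * y = 0 := by
  have hx : 0 ≤ x := h ▸ inf_le_left
  have hy : 0 ≤ y := h ▸ inf_le_right
  have h1 := IsFAlgebra.mul_inf_eq_zero x y y h hy
  rw [inf_comm] at h1
  have h2 := IsFAlgebra.mul_inf_eq_zero' _ _ x h1 hx
  rwa [inf_idem] at h2

/-- The unit splits as `1 = 1⁺ - 1⁻` with `1⁺ 1⁻ = 1⁻ 1⁺ = 0`, so `1 = 1² = (1⁺)² + (1⁻)²`. -/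
theorem zero_le_one_of_isFAlgebra : (0 : E) ≤ 1 := by
  have h : (1 : E)⁺ ⊓ (1 : E)⁻ = 0 := posPart_inf_negPart_eq_zero 1
  have h1 := mul_eq_zero_of_inf_eq_zero h
  have h2 := mul_eq_zero_of_inf_eq_zero ((inf_comm _ _).trans h)
  have h3 : (1 : E) = (1 : E)⁺ * (1 : E)⁺ + (1 : E)⁻ * (1 : E)⁻ := by
    have : (1 : E) = ((1 : E)⁺ - (1 : E)⁻) * ((1 : E)⁺ - (1 : E)⁻) := by
      rw [posPart_sub_negPart, one_mul]
    simpa only [sub_mul, mul_sub, h1, h2, sub_zero, zero_sub, sub_neg_eq_add] using this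
  rw [h3]
  exact add_nonneg (IsFAlgebra.mul_nonneg _ _ (posPart_nonneg _) (posPart_nonneg _))
    (IsFAlgebra.mul_nonneg _ _ (negPart_nonneg _) (negPart_nonneg _))

instance instIsOrderedRing : IsOrderedRing E :=
  have : ZeroLEOneClass E := ⟨zero_le_one_of_isFAlgebra⟩
  IsOrderedRing.of_mul_nonneg fun x y hx hy => IsFAlgebra.mul_nonneg x y hx hy

theorem sub_inf_inf_sub_inf (x y : E) : (x - x ⊓ y) ⊓ (y - x ⊓ y) = 0 := by
  rw [← inf_sub, sub_self]

/-- `truncStep y k` is the part of `y` between the levels `k` and `k + 1`. -/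
def truncStep (y : E) (k : ℕ) : E := y ⊓ ((k + 1 : ℕ) : E) - y ⊓ (k : E)

theorem truncStep_nonneg (y : E) (k : ℕ) : 0 ≤ truncStep y k :=
  sub_nonneg.2 (inf_le_inf_left _ (Nat.mono_cast k.le_succ))

theorem truncStep_le_one (y : E) (k : ℕ) : truncStep y k ≤ 1 := by
  rw [truncStep, sub_le_iff_le_add', inf_add, Nat.cast_succ]
  exact inf_le_inf_right _ (le_add_of_nonneg_right zero_le_one)

theorem one_sub_truncStep_inf (y : E) (k : ℕ) :
    (1 - truncStep y k) ⊓ truncStep y (k + 1) = 0 := by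
  apply le_antisymm
  · rw [← sub_inf_inf_sub_inf y ((k + 1 : ℕ) : E), inf_comm]
    apply inf_le_inf
    · exact sub_le_sub_right inf_le_left _
    · have : y ⊓ (k : E) + 1 ≤ ((k + 1 : ℕ) : E) := by
        rw [Nat.cast_succ]; exact add_le_add_left inf_le_right _
      rw [truncStep, sub_sub_eq_add_sub, add_comm]
      exact sub_le_sub_right this _
  · exact le_inf (sub_nonneg.2 (truncStep_le_one _ _)) (truncStep_nonneg _ _)

theorem sum_truncStep {y : E} (hy : 0 ≤ y) (N : ℕ) :
    ∑ k ∈ Finset.range N, truncStep y k = y ⊓ (N : E) := by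
  simp only [truncStep]
  rw [Finset.sum_range_sub (fun k : ℕ => y ⊓ (k : E))]
  simp [inf_eq_right.2 hy]

/-- Disjointness of `1 - truncStep y k` and `truncStep y (k + 1)` lets `x` move past a truncation
step at the cost of lowering the level by one. -/
theorem mul_truncStep_succ_le {x : E} (hx : 0 ≤ x) (y : E) (k : ℕ) :
    x * truncStep y (k + 1) ≤ truncStep y k * x := by
  have h := mul_eq_zero_of_inf_eq_zero
    (IsFAlgebra.mul_inf_eq_zero _ _ x (one_sub_truncStep_inf y k) hx)
  rw [sub_mul, one_mul, sub_mul, sub_eq_zero] at h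
  rw [h]
  exact mul_le_of_le_one_right (mul_nonneg (truncStep_nonneg _ _) hx) (truncStep_le_one _ _)

theorem truncStep_succ_mul_le {x : E} (hx : 0 ≤ x) (y : E) (k : ℕ) :
    truncStep y (k + 1) * x ≤ x * truncStep y k := by
  have h := mul_eq_zero_of_inf_eq_zero
    (IsFAlgebra.mul_inf_eq_zero _ _ x ((inf_comm _ _).trans (one_sub_truncStep_inf y k)) hx)
  rw [mul_sub, mul_one, sub_eq_zero] at h
  rw [h, mul_assoc]
  exact mul_le_of_le_one_left (mul_nonneg hx (truncStep_nonneg _ _)) (truncStep_le_one _ _)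

/-- The sum of `mul_truncStep_succ_le` over all levels below `N`; only the lowest step is lost, which
costs `x`. -/
theorem mul_inf_natCast_le {x y : E} (hx : 0 ≤ x) (hy : 0 ≤ y) (N : ℕ) :
    x * (y ⊓ (N : E)) ≤ x + (y ⊓ (N : E)) * x := by
  rw [← sum_truncStep hy, Finset.mul_sum, Finset.sum_mul]
  cases N with
  | zero => simpa using hx
  | succ N =>
    rw [Finset.sum_range_succ', add_comm]
    refine add_le_add (mul_le_of_le_one_right hx (truncStep_le_one _ _)) ?_
    rw [Finset.sum_range_succ]
    exact (Finset.sum_le_sum fun k _ => mul_truncStep_succ_le hx y k).trans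
      (le_add_of_nonneg_right (mul_nonneg (truncStep_nonneg _ _) hx))

theorem inf_natCast_mul_le {x y : E} (hx : 0 ≤ x) (hy : 0 ≤ y) (N : ℕ) :
    (y ⊓ (N : E)) * x ≤ x + x * (y ⊓ (N : E)) := by
  rw [← sum_truncStep hy, Finset.mul_sum, Finset.sum_mul]
  cases N with
  | zero => simpa using hx
  | succ N =>
    rw [Finset.sum_range_succ', add_comm]
    refine add_le_add (mul_le_of_le_one_left hx (truncStep_le_one _ _)) ?_
    rw [Finset.sum_range_succ]
    exact (Finset.sum_le_sum fun k _ => truncStep_succ_mul_le hx y k).trans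
      (le_add_of_nonneg_right (mul_nonneg hx (truncStep_nonneg _ _)))

end Ring

section Complete

variable {E : Type u} [Ring E] [ConditionallyCompleteLattice E] [IsOrderedAddMonoid E]

/-- A Dedekind complete lattice-ordered group is Archimedean. -/
theorem nonpos_of_forall_nsmul_le {x y : E} (h : ∀ n : ℕ, n • x ≤ y) : x ≤ 0 := by
  have hb : BddAbove (Set.range fun n : ℕ => n • x) := ⟨y, by rintro _ ⟨n, rfl⟩; exact h n⟩
  have : sSup (Set.range fun n : ℕ => n • x) ≤ sSup (Set.range fun n : ℕ => n • x) - x := by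
    refine csSup_le (Set.range_nonempty _) ?_
    rintro _ ⟨n, rfl⟩
    rw [le_sub_iff_add_le, ← succ_nsmul]
    exact le_csSup hb ⟨n + 1, rfl⟩
  simpa using this

variable [IsFAlgebra E]

/-- Applied to `n y`, the truncation estimates give `n (x y - y x) ≤ x` and `n (y x - x y) ≤ x`. -/
theorem mul_comm_of_le_natCast {x y : E} (hx : 0 ≤ x) (hy : 0 ≤ y) {m : ℕ} (hm : y ≤ m) :
    x * y = y * x := by
  have key : ∀ n : ℕ, (n • y) ⊓ ((n * m : ℕ) : E) = n • y := fun n => by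
    rw [inf_eq_left, Nat.cast_mul, ← nsmul_eq_mul]
    exact nsmul_le_nsmul_right hm n
  apply le_antisymm <;> rw [← sub_nonpos] <;>
    refine nonpos_of_forall_nsmul_le (y := x) fun n => ?_
  · have := mul_inf_natCast_le hx (nsmul_nonneg hy n) (n * m)
    rwa [key, mul_smul_comm, smul_mul_assoc, ← sub_le_iff_le_add, ← smul_sub] at this
  · have := inf_natCast_mul_le hx (nsmul_nonneg hy n) (n * m)
    rwa [key, mul_smul_comm, smul_mul_assoc, ← sub_le_iff_le_add, ← smul_sub] at this

/-- With `c = x y - y x`, the element `(m - y)⁺` annihilates `c`, because truncations of `y` commute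
with `x`; hence `m c⁺ ≤ y c⁺` for every `m`. -/
theorem mul_le_mul_swap {x y : E} (hx : 0 ≤ x) (hy : 0 ≤ y) : x * y ≤ y * x := by
  rw [← sub_nonpos, ← posPart_eq_zero]
  refine le_antisymm (nonpos_of_forall_nsmul_le (y := y * (x * y - y * x)⁺) fun m => ?_)
    (posPart_nonneg _)
  set c := x * y - y * x with hc
  set t := y ⊓ (m : E) with ht
  have htm : t ≤ m := inf_le_right
  have ht0 : 0 ≤ t := le_inf hy (Nat.cast_nonneg m)
  have hd := sub_inf_inf_sub_inf (m : E) y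
  rw [inf_comm (m : E) y, ← ht] at hd
  have hv : 0 ≤ (m : E) - t := sub_nonneg.2 htm
  have h1 := mul_eq_zero_of_inf_eq_zero hd
  have h2 := mul_eq_zero_of_inf_eq_zero (IsFAlgebra.mul_inf_eq_zero _ _ x hd hx)
  have hcc : c = x * (y - t) - (y - t) * x := by
    rw [hc, mul_sub, sub_mul, mul_comm_of_le_natCast hx ht0 htm]; abel
  have hvc : ((m : E) - t) * c = 0 := by
    rw [hcc, mul_sub, ← mul_assoc, ← mul_assoc, h1, h2, zero_mul, sub_zero]
  have hpm : ((m : E) - t) * c⁺ = ((m : E) - t) * c⁻ := by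
    rw [← sub_eq_zero, ← mul_sub, posPart_sub_negPart, hvc]
  have hdis := IsFAlgebra.mul_inf_eq_zero' _ _ _ (posPart_inf_negPart_eq_zero c) hv
  rw [inf_comm] at hdis
  have hdis := IsFAlgebra.mul_inf_eq_zero' _ _ _ hdis hv
  rw [← hpm, inf_idem, sub_mul, sub_eq_zero, ← nsmul_eq_mul] at hdis
  rw [hdis]
  exact mul_le_mul_of_nonneg_right inf_le_left (posPart_nonneg _)

theorem mul_comm_of_isFAlgebra (x y : E) : x * y = y * x := by
  have h : ∀ {x y : E}, 0 ≤ x → 0 ≤ y → x * y = y * x := fun hx hy =>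
    le_antisymm (mul_le_mul_swap hx hy) (mul_le_mul_swap hy hx)
  rw [← posPart_sub_negPart x, ← posPart_sub_negPart y]
  simp only [sub_mul, mul_sub, h (posPart_nonneg x) (posPart_nonneg y),
    h (posPart_nonneg x) (negPart_nonneg y), h (negPart_nonneg x) (posPart_nonneg y),
    h (negPart_nonneg x) (negPart_nonneg y)]
  abel

/-- The commutative ring structure of a Dedekind complete unital `f`-algebra. -/
abbrev commRingOfIsFAlgebra (E : Type u) [inst : Ring E] [ConditionallyCompleteLattice E]
    [IsOrderedAddMonoid E] [IsFAlgebra E] : CommRing E :=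
  { inst with mul_comm := mul_comm_of_isFAlgebra }

end Complete

/-! ### Arithmetic of the algebra -/

section Comm

variable {E : Type u} [CommRing E] [ConditionallyCompleteLattice E] [IsOrderedAddMonoid E]
  [IsFAlgebra E]

/-- Multiplication by a nonnegative element is a lattice homomorphism, because it preserves the
disjointness of `x - x ⊓ y` and `y - x ⊓ y`. -/
theorem mul_inf_of_nonneg {p : E} (hp : 0 ≤ p) (x y : E) : p * (x ⊓ y) = p * x ⊓ p * y := by
  have h := IsFAlgebra.mul_inf_eq_zero' _ _ p (sub_inf_inf_sub_inf x y) hp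
  rw [inf_comm] at h
  have h := IsFAlgebra.mul_inf_eq_zero' _ _ p h hp
  rw [mul_sub, mul_sub, ← inf_sub, sub_eq_zero, inf_comm] at h
  exact h.symm

theorem mul_sup_of_nonneg {p : E} (hp : 0 ≤ p) (x y : E) : p * (x ⊔ y) = p * x ⊔ p * y := by
  have h := mul_inf_of_nonneg hp (-x) (-y)
  simpa only [mul_neg, ← neg_sup, neg_inj] using h

theorem abs_eq_zero_iff_of_isFAlgebra {x : E} : |x| = 0 ↔ x = 0 :=
  ⟨fun h => le_antisymm (h ▸ le_abs_self x) (neg_nonpos.1 (h ▸ neg_le_abs x)),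
    fun h => by rw [h, abs_zero]⟩

theorem abs_eq_zero_of_nonpos {x : E} (h : |x| ≤ 0) : x = 0 :=
  abs_eq_zero_iff_of_isFAlgebra.1 (le_antisymm h (abs_nonneg x))

theorem mul_posPart_of_nonneg {p : E} (hp : 0 ≤ p) (x : E) : p * x⁺ = (p * x)⁺ := by
  rw [posPart_def, posPart_def, mul_sup_of_nonneg hp, mul_zero]

theorem mul_abs_of_nonneg {p : E} (hp : 0 ≤ p) (x : E) : p * |x| = |p * x| := by
  rw [abs, abs, mul_sup_of_nonneg hp, mul_neg]

theorem abs_mul_le_mul_abs (x y : E) : |x * y| ≤ |x| * |y| := by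
  have h : ∀ z : E, z * y ≤ |z| * |y| := fun z => by
    have h1 : z * y ≤ z⁺ * |y| + z⁻ * |y| := by
      have e : z * y = z⁺ * y + z⁻ * (-y) := by
        conv_lhs => rw [← posPart_sub_negPart z]
        ring
      rw [e]
      exact add_le_add (mul_le_mul_of_nonneg_left (le_abs_self y) (posPart_nonneg _))
        (mul_le_mul_of_nonneg_left (neg_le_abs y) (negPart_nonneg _))
    rwa [← add_mul, posPart_add_negPart] at h1
  rw [abs_le']
  refine ⟨h x, ?_⟩
  simpa using h (-x)

theorem abs_mul_abs_self_of_isFAlgebra (x : E) : |x| * |x| = x * x := by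
  have h := mul_eq_zero_of_inf_eq_zero (posPart_inf_negPart_eq_zero x)
  conv_rhs => rw [← posPart_sub_negPart x]
  rw [← posPart_add_negPart]
  linear_combination (4 : E) * h

theorem mul_self_nonneg_of_isFAlgebra (x : E) : 0 ≤ x * x :=
  abs_mul_abs_self_of_isFAlgebra x ▸ mul_nonneg (abs_nonneg x) (abs_nonneg x)

/-- The algebra is reduced: if `x² = 0`, then `0 ≤ (n |x| - 1)² = 1 - 2 n |x|` for all `n`. -/
theorem eq_zero_of_mul_self_eq_zero {x : E} (h : x * x = 0) : x = 0 := by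
  rw [← abs_mul_abs_self_of_isFAlgebra] at h
  refine abs_eq_zero_of_nonpos (nonpos_of_forall_nsmul_le (y := 1) fun n => ?_)
  have h3 := mul_self_nonneg_of_isFAlgebra (n • |x| - 1)
  have h4 : (n • |x| - 1) * (n • |x| - 1) = 1 - (n • |x| + n • |x|) := by
    rw [nsmul_eq_mul]; linear_combination (n : E) ^ 2 * h
  rw [h4, sub_nonneg] at h3
  exact (le_add_of_nonneg_left (nsmul_nonneg (abs_nonneg x) n)).trans h3

theorem inf_eq_zero_iff_mul_eq_zero {x y : E} (hx : 0 ≤ x) (hy : 0 ≤ y) :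
    x ⊓ y = 0 ↔ x * y = 0 := by
  refine ⟨mul_eq_zero_of_inf_eq_zero, fun h => eq_zero_of_mul_self_eq_zero (le_antisymm ?_ ?_)⟩
  · exact h ▸ mul_le_mul inf_le_left inf_le_right (le_inf hx hy) hx
  · exact mul_self_nonneg_of_isFAlgebra _

theorem mul_eq_zero_of_abs_inf_abs_eq_zero {x y : E} (h : |x| ⊓ |y| = 0) : x * y = 0 :=
  abs_eq_zero_of_nonpos ((abs_mul_le_mul_abs x y).trans_eq (mul_eq_zero_of_inf_eq_zero h))

theorem abs_inf_eq_zero_iff {x u : E} (hu : 0 ≤ u) : |x| ⊓ u = 0 ↔ x * u = 0 := by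
  rw [inf_eq_zero_iff_mul_eq_zero (abs_nonneg x) hu, mul_comm, mul_abs_of_nonneg hu, mul_comm u]
  exact ⟨fun h => abs_eq_zero_iff_of_isFAlgebra.1 h, fun h => by rw [h, abs_zero]⟩

/-! ### Weak order units -/

theorem isWeakOrderUnit_iff {u : E} :
    IsWeakOrderUnit u ↔ 0 ≤ u ∧ ∀ x : E, x * u = 0 → x = 0 :=
  and_congr_right fun hu => by simp only [abs_inf_eq_zero_iff hu]

theorem IsWeakOrderUnit.mono {u v : E} (hu : IsWeakOrderUnit u) (huv : u ≤ v) :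
    IsWeakOrderUnit v :=
  ⟨hu.1.trans huv, fun x hx => hu.2 x (le_antisymm (hx ▸ inf_le_inf_left _ huv)
    (le_inf (abs_nonneg x) hu.1))⟩

theorem IsWeakOrderUnit.inf {u v : E} (hu : IsWeakOrderUnit u) (hv : IsWeakOrderUnit v) :
    IsWeakOrderUnit (u ⊓ v) := by
  refine ⟨le_inf hu.1 hv.1, fun x hx => hu.2 x ?_⟩
  have h := hv.2 (|x| ⊓ u)
  rw [abs_of_nonneg (le_inf (abs_nonneg x) hu.1), inf_assoc] at h
  exact h hx

theorem IsWeakOrderUnit.mul {u v : E} (hu : IsWeakOrderUnit u) (hv : IsWeakOrderUnit v) :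
    IsWeakOrderUnit (u * v) := by
  rw [isWeakOrderUnit_iff] at *
  exact ⟨mul_nonneg hu.1 hv.1, fun x hx => hu.2 x (hv.2 _ (by rw [mul_assoc, hx]))⟩

/-! ### Halving and the Archimedean property -/

section Half

variable (E) [Algebra ℝ E] [PosSMulMono ℝ E]

/-- The scalar `1 / 2` as an element of the algebra. -/
def half : E := (1 / 2 : ℝ) • 1

theorem half_add_half : half E + half E = 1 := by
  rw [half, ← add_smul]; norm_num

theorem half_nonneg : 0 ≤ half E := smul_nonneg (by norm_num) zero_le_one

theorem half_pow_nonneg (n : ℕ) : 0 ≤ half E ^ n := pow_nonneg (half_nonneg E) n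

theorem half_le_one : half E ≤ 1 := by
  rw [← half_add_half]; exact le_add_of_nonneg_left (half_nonneg E)

theorem two_pow_mul_half_pow (n : ℕ) : 2 ^ n * half E ^ n = 1 := by
  rw [← mul_pow, two_mul, half_add_half, one_pow]

theorem isWeakOrderUnit_half : IsWeakOrderUnit (half E) :=
  isWeakOrderUnit_iff.2 ⟨half_nonneg E, fun x hx => by
    rw [← mul_one x, ← half_add_half E, mul_add, hx, add_zero]⟩

variable {E}

theorem nonpos_of_forall_two_pow_mul_le {x y : E} (hx : 0 ≤ x) (h : ∀ n : ℕ, 2 ^ n * x ≤ y) :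
    x ≤ 0 := by
  refine nonpos_of_forall_nsmul_le fun n => le_trans ?_ (h n)
  rw [nsmul_eq_mul]
  refine mul_le_mul_of_nonneg_right ?_ hx
  exact_mod_cast Nat.mono_cast (α := E) n.lt_two_pow_self.le

theorem nonpos_of_forall_le_half_pow_mul {x y : E} (h : ∀ n : ℕ, x ≤ half E ^ n * y) : x ≤ 0 := by
  rw [← posPart_eq_zero]
  refine le_antisymm (nonpos_of_forall_two_pow_mul_le (y := y⁺) (posPart_nonneg x) fun n => ?_)
    (posPart_nonneg x)
  have h1 : x⁺ ≤ half E ^ n * y⁺ := by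
    rw [mul_posPart_of_nonneg (half_pow_nonneg E n)]; exact posPart_mono (h n)
  have h2 := mul_le_mul_of_nonneg_left h1 (pow_nonneg zero_le_two n : (0 : E) ≤ 2 ^ n)
  rwa [← mul_assoc, two_pow_mul_half_pow, one_mul] at h2

/-- Multiplication by `u ≥ 0` is order continuous. With `v = (2ⁿ - u)⁺` the product `v u` is bounded by
`4ⁿ`, so the claim holds after multiplication by `v`; then `n` tends to infinity. -/
theorem nonpos_of_forall_le_mul {S : Set E} (hS : IsGLB S 0) {u w : E} (hu : 0 ≤ u)
    (h : ∀ s ∈ S, w ≤ u * s) : w ≤ 0 := by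
  rw [← posPart_eq_zero]
  refine le_antisymm (nonpos_of_forall_two_pow_mul_le (y := u * w⁺) (posPart_nonneg w) fun n => ?_)
    (posPart_nonneg w)
  set t := u ⊓ (2 : E) ^ n with ht
  have htn : t ≤ 2 ^ n := inf_le_right
  have h2n : (0 : E) ≤ 2 ^ n := pow_nonneg zero_le_two n
  have ht0 : 0 ≤ t := le_inf hu h2n
  have hv : 0 ≤ 2 ^ n - t := sub_nonneg.2 htn
  have hvu : (2 ^ n - t) * (u - t) = 0 := by
    have := sub_inf_inf_sub_inf u ((2 : E) ^ n)
    rw [mul_comm]; exact mul_eq_zero_of_inf_eq_zero this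
  have hvu' : (2 ^ n - t) * u ≤ 2 ^ n * 2 ^ n := by
    rw [mul_sub, sub_eq_zero] at hvu
    rw [hvu]
    exact mul_le_mul (sub_le_self _ ht0) htn ht0 h2n
  have hvw : (2 ^ n - t) * w ≤ 0 := by
    have h1 : half E ^ n * half E ^ n * ((2 ^ n - t) * w) ≤ 0 := hS.2 fun s hs => by
      have hs0 : 0 ≤ s := hS.1 hs
      calc half E ^ n * half E ^ n * ((2 ^ n - t) * w)
          ≤ half E ^ n * half E ^ n * ((2 ^ n - t) * (u * s)) := by
            refine mul_le_mul_of_nonneg_left (mul_le_mul_of_nonneg_left (h s hs) hv) ?_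
            exact mul_nonneg (half_pow_nonneg E n) (half_pow_nonneg E n)
        _ = half E ^ n * half E ^ n * ((2 ^ n - t) * u * s) := by ring
        _ ≤ half E ^ n * half E ^ n * (2 ^ n * 2 ^ n * s) := by
            refine mul_le_mul_of_nonneg_left (mul_le_mul_of_nonneg_right hvu' hs0) ?_
            exact mul_nonneg (half_pow_nonneg E n) (half_pow_nonneg E n)
        _ = (2 ^ n * half E ^ n) * (2 ^ n * half E ^ n) * s := by ring
        _ = s := by rw [two_pow_mul_half_pow, one_mul, one_mul]
    have h2 := mul_nonpos_of_nonneg_of_nonpos (mul_nonneg h2n h2n) h1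
    have h3 : 2 ^ n * 2 ^ n * (half E ^ n * half E ^ n * ((2 ^ n - t) * w)) =
        (2 ^ n * half E ^ n) * (2 ^ n * half E ^ n) * ((2 ^ n - t) * w) := by ring
    rwa [h3, two_pow_mul_half_pow, one_mul, one_mul] at h2
  rw [← posPart_eq_zero, ← mul_posPart_of_nonneg hv, sub_mul, sub_eq_zero] at hvw
  rw [hvw]
  exact mul_le_mul_of_nonneg_right inf_le_left (posPart_nonneg w)

end Half

/-! ### Idempotents and band projections -/

theorem IsIdempotentElem.nonneg_of_isFAlgebra {p : E} (hp : IsIdempotentElem p) : 0 ≤ p :=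
  hp.eq ▸ mul_self_nonneg_of_isFAlgebra p

theorem IsIdempotentElem.le_one_of_isFAlgebra {p : E} (hp : IsIdempotentElem p) : p ≤ 1 :=
  sub_nonneg.1 (IsIdempotentElem.nonneg_of_isFAlgebra hp.one_sub)

section Carrier

variable [Algebra ℝ E] [PosSMulMono ℝ E]

/-- The idempotent whose band is generated by `u`. Its complement is the largest `s` with
`0 ≤ s ≤ 1` and `u s = 0`; it is idempotent because `2 s - s²` competes with `s`. -/
theorem exists_carrier {u : E} (hu : 0 ≤ u) :
    ∃ p : E, IsIdempotentElem p ∧ p * u = u ∧ ∀ v, u * v = 0 → p * v = 0 := by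
  let S : Set E := {s | 0 ≤ s ∧ s ≤ 1 ∧ u * s = 0}
  have h0 : (0 : E) ∈ S := ⟨le_rfl, zero_le_one, mul_zero u⟩
  have hb : BddAbove S := ⟨1, fun s hs => hs.2.1⟩
  set e := sSup S with he
  have hlub : IsLUB S e := isLUB_csSup ⟨0, h0⟩ hb
  have he0 : 0 ≤ e := hlub.1 h0
  have he1 : e ≤ 1 := hlub.2 fun s hs => hs.2.1
  have hue : u * e = 0 := by
    refine le_antisymm (nonpos_of_forall_le_mul (S := (fun s => e - s) '' S) ⟨?_, ?_⟩ hu ?_)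
      (mul_nonneg hu he0)
    · rintro _ ⟨s, hs, rfl⟩; exact sub_nonneg.2 (hlub.1 hs)
    · intro w hw
      have : e ≤ e - w := hlub.2 fun s hs => le_sub_comm.1 (hw ⟨s, hs, rfl⟩)
      simpa using this
    · rintro _ ⟨s, hs, rfl⟩
      rw [mul_sub, hs.2.2, sub_zero]
  have hee : e * e = e := by
    apply le_antisymm (mul_le_of_le_one_left he0 he1)
    have hmem : 2 * e - e * e ∈ S := by
      refine ⟨?_, ?_, ?_⟩
      · rw [show 2 * e - e * e = e + e * (1 - e) by ring]
        exact add_nonneg he0 (mul_nonneg he0 (sub_nonneg.2 he1))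
      · rw [show 2 * e - e * e = 1 - (1 - e) * (1 - e) by ring]
        exact sub_le_self _ (mul_self_nonneg_of_isFAlgebra _)
      · linear_combination (2 - e) * hue
    linear_combination hlub.1 hmem
  have hp : IsIdempotentElem (1 - e) := IsIdempotentElem.one_sub hee
  refine ⟨1 - e, hp, by linear_combination -hue, fun v hv => ?_⟩
  have hp0 := IsIdempotentElem.nonneg_of_isFAlgebra hp
  have hv' : u * |v| = 0 := by rw [mul_abs_of_nonneg hu, hv, abs_zero]
  have hmem : |v| ⊓ 1 ∈ S := by
    refine ⟨le_inf (abs_nonneg v) zero_le_one, inf_le_right, le_antisymm ?_ ?_⟩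
    · rw [← hv']; exact mul_le_mul_of_nonneg_left inf_le_left hu
    · exact mul_nonneg hu (le_inf (abs_nonneg v) zero_le_one)
  have h1 : (1 - e) * (|v| ⊓ 1) = 0 := by
    refine le_antisymm ?_ (mul_nonneg hp0 (le_inf (abs_nonneg v) zero_le_one))
    refine (mul_le_mul_of_nonneg_left (hlub.1 hmem) hp0).trans_eq ?_
    linear_combination -hee
  rw [mul_inf_of_nonneg hp0, mul_one, mul_abs_of_nonneg hp0, abs_inf_eq_zero_iff hp0] at h1
  linear_combination h1 - v * hp.eq

/-- Locally the order is total: an idempotent separates the region where `y ≤ x` from a region where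
`x ≤ y`. -/
theorem exists_idempotent_mul_le (x y : E) :
    ∃ p : E, IsIdempotentElem p ∧ p * y ≤ p * x ∧ (1 - p) * x ≤ (1 - p) * y := by
  obtain ⟨p, hp, h1, h2⟩ := exists_carrier (posPart_nonneg (x - y))
  have h3 := h2 _ (mul_eq_zero_of_inf_eq_zero (posPart_inf_negPart_eq_zero (x - y)))
  have h4 : x - y = (x - y)⁺ - (x - y)⁻ := (posPart_sub_negPart _).symm
  refine ⟨p, hp, ?_, ?_⟩ <;> rw [← sub_nonneg]
  · rw [show p * x - p * y = (x - y)⁺ by linear_combination p * h4 + h1 - h3]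
    exact posPart_nonneg _
  · rw [show (1 - p) * y - (1 - p) * x = (x - y)⁻ by
      linear_combination (p - 1) * h4 + h1 - h3]
    exact negPart_nonneg _

end Carrier

section Band

variable [Algebra ℝ E]

/-- The band of the projection is `{x | (1 - p) x = 0}`. -/
theorem isBandProjection_mulLeft {p : E} (hp : IsIdempotentElem p) :
    IsBandProjection (LinearMap.mulLeft ℝ p) := by
  have hq := hp.one_sub
  have hp0 := IsIdempotentElem.nonneg_of_isFAlgebra hp
  have hq0 := IsIdempotentElem.nonneg_of_isFAlgebra hq
  refine ⟨LinearMap.ker (LinearMap.mulLeft ℝ (1 - p)), ⟨?_, ?_⟩, fun x => ⟨?_, ?_⟩⟩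
  · intro x hx y hyx
    rw [LinearMap.mem_ker, LinearMap.mulLeft_apply] at *
    have h := mul_le_mul_of_nonneg_left hyx hq0
    rw [mul_abs_of_nonneg hq0, mul_abs_of_nonneg hq0, hx, abs_zero] at h
    exact abs_eq_zero_of_nonpos h
  · intro S hS x hx
    rw [LinearMap.mem_ker, LinearMap.mulLeft_apply]
    have hSp : ∀ s ∈ S, (1 - p) * s = 0 := fun s hs => hS hs
    have h1 : x ≤ p * x := hx.2 fun s hs => by
      rw [show s = p * s by linear_combination hSp s hs]
      exact mul_le_mul_of_nonneg_left (hx.1 hs) hp0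
    refine le_antisymm (by linear_combination h1) ?_
    rcases S.eq_empty_or_nonempty with rfl | ⟨s, hs⟩
    -- an upper bound of the empty set is arbitrary, so `x` is the least element of `E`
    · have h2 : x ≤ x + (1 - p) * x := hx.2 (by simp)
      linear_combination h2
    · rw [← hSp s hs]; exact mul_le_mul_of_nonneg_left (hx.1 hs) hq0
  · rw [LinearMap.mem_ker, LinearMap.mulLeft_apply, LinearMap.mulLeft_apply]
    linear_combination -x * hp.eq
  · intro y hy
    rw [LinearMap.mem_ker, LinearMap.mulLeft_apply] at hy
    rw [abs_inf_eq_zero_iff (abs_nonneg y), ← abs_eq_zero_iff_of_isFAlgebra, mul_comm,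
      ← mul_abs_of_nonneg (abs_nonneg y), LinearMap.mulLeft_apply]
    rw [show x - p * x = (1 - p) * x by ring, ← mul_abs_of_nonneg hq0]
    rw [show |y| * ((1 - p) * |x|) = ((1 - p) * |y|) * |x| by ring, mul_abs_of_nonneg hq0, hy,
      abs_zero, zero_mul]

/-- Every band projection is multiplication by an idempotent, namely by the image of `1`. -/
theorem IsBandProjection.exists_eq_mul {P : E →ₗ[ℝ] E} (hP : IsBandProjection P) :
    ∃ p : E, IsIdempotentElem p ∧ ∀ x, P x = p * x := by
  obtain ⟨B, -, h⟩ := hP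
  have key : ∀ x y : E, (x - P x) * P y = 0 := fun x y =>
    mul_eq_zero_of_abs_inf_abs_eq_zero ((h x).2 _ (h y).1)
  exact ⟨P 1, by rw [IsIdempotentElem]; linear_combination -key 1 1, fun x => by
    linear_combination key 1 x - key x 1⟩

theorem LocallyBandPreservingOn.mul_eq {f : E → E} {s : Set E} (hf : LocallyBandPreservingOn f s)
    {p : E} (hp : IsIdempotentElem p) {x y : E} (hx : x ∈ s) (hy : y ∈ s) (h : p * x = p * y) :
    p * f x = p * f y :=
  hf _ (isBandProjection_mulLeft hp) x hx y hy h

end Band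

end Comm

/-! ### Bounded locally band preserving functions -/

section Functions

variable {E : Type u} [CommRing E] [ConditionallyCompleteLattice E] [IsOrderedAddMonoid E]
  [IsFAlgebra E] {a b : E} {f g : E → E}

theorem OrderBoundedOn.neg {s : Set E} (hf : OrderBoundedOn f s) :
    OrderBoundedOn (fun x => -f x) s := by
  obtain ⟨⟨l, hl⟩, ⟨m, hm⟩⟩ := hf
  refine ⟨⟨-m, ?_⟩, ⟨-l, ?_⟩⟩ <;> rintro _ ⟨x, hx, rfl⟩
  · exact neg_le_neg (hm ⟨x, hx, rfl⟩)
  · exact neg_le_neg (hl ⟨x, hx, rfl⟩)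

theorem OrderBoundedOn.exists_abs_le {s : Set E} (hf : OrderBoundedOn f s) :
    ∃ K : E, 0 ≤ K ∧ ∀ x ∈ s, |f x| ≤ K := by
  obtain ⟨⟨l, hl⟩, ⟨m, hm⟩⟩ := hf
  refine ⟨|l| ⊔ |m|, (abs_nonneg l).trans le_sup_left, fun x hx => abs_le'.2 ⟨?_, ?_⟩⟩
  · exact (hm ⟨x, hx, rfl⟩).trans ((le_abs_self m).trans le_sup_right)
  · exact (neg_le_neg (hl ⟨x, hx, rfl⟩)).trans ((neg_le_abs l).trans le_sup_left)

theorem OrderBoundedOn.of_abs_le {s : Set E} {K : E} (h : ∀ x ∈ s, |f x| ≤ K) :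
    OrderBoundedOn f s := by
  refine ⟨⟨-K, ?_⟩, ⟨K, ?_⟩⟩ <;> rintro _ ⟨x, hx, rfl⟩
  · exact neg_le.1 ((neg_le_abs _).trans (h x hx))
  · exact (le_abs_self _).trans (h x hx)

theorem OrderBoundedOn.mul {s : Set E} (hf : OrderBoundedOn f s) (hg : OrderBoundedOn g s) :
    OrderBoundedOn (fun x => f x * g x) s := by
  obtain ⟨K, hK, hfK⟩ := hf.exists_abs_le
  obtain ⟨M, _, hgM⟩ := hg.exists_abs_le
  exact .of_abs_le (K := K * M) fun x hx => (abs_mul_le_mul_abs _ _).trans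
    (mul_le_mul (hfK x hx) (hgM x hx) (abs_nonneg _) hK)

theorem OrderBoundedOn.le_sSup (hf : OrderBoundedOn f (Set.Icc a b)) {x y z : E} (hax : a ≤ x)
    (hyb : y ≤ b) (hz : z ∈ Set.Icc x y) : f z ≤ sSup (f '' Set.Icc x y) :=
  le_csSup (hf.2.mono (Set.image_mono (Set.Icc_subset_Icc hax hyb))) ⟨z, hz, rfl⟩

theorem OrderBoundedOn.sInf_le (hf : OrderBoundedOn f (Set.Icc a b)) {x y z : E} (hax : a ≤ x)
    (hyb : y ≤ b) (hz : z ∈ Set.Icc x y) : sInf (f '' Set.Icc x y) ≤ f z :=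
  csInf_le (hf.1.mono (Set.image_mono (Set.Icc_subset_Icc hax hyb))) ⟨z, hz, rfl⟩

theorem sSup_image_le {x y c : E} (hxy : x ≤ y) (h : ∀ z ∈ Set.Icc x y, f z ≤ c) :
    sSup (f '' Set.Icc x y) ≤ c :=
  csSup_le ((Set.nonempty_Icc.2 hxy).image f) (by rintro _ ⟨z, hz, rfl⟩; exact h z hz)

theorem le_sInf_image {x y c : E} (hxy : x ≤ y) (h : ∀ z ∈ Set.Icc x y, c ≤ f z) :
    c ≤ sInf (f '' Set.Icc x y) :=
  le_csInf ((Set.nonempty_Icc.2 hxy).image f) (by rintro _ ⟨z, hz, rfl⟩; exact h z hz)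

theorem OrderBoundedOn.sInf_eq_neg (hf : OrderBoundedOn f (Set.Icc a b)) {x y : E} (hax : a ≤ x)
    (hxy : x ≤ y) (hyb : y ≤ b) :
    sInf (f '' Set.Icc x y) = -sSup ((fun z => -f z) '' Set.Icc x y) := by
  apply le_antisymm
  · exact le_neg.1 (sSup_image_le hxy fun z hz => neg_le_neg (hf.sInf_le hax hyb hz))
  · exact le_sInf_image hxy fun z hz => neg_le.1 (hf.neg.le_sSup hax hyb hz)

theorem mul_add_one_sub_mul_mem_Icc {p x y u v : E} (hp : IsIdempotentElem p)
    (hx1 : p * u ≤ p * x) (hx2 : p * x ≤ p * v) (hy : y ∈ Set.Icc u v) :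
    p * x + (1 - p) * y ∈ Set.Icc u v := by
  have hq := IsIdempotentElem.nonneg_of_isFAlgebra hp.one_sub
  have h1 := add_le_add hx1 (mul_le_mul_of_nonneg_left hy.1 hq)
  have h2 := add_le_add hx2 (mul_le_mul_of_nonneg_left hy.2 hq)
  exact ⟨by linear_combination h1, by linear_combination h2⟩

theorem mul_glue {p : E} (hp : IsIdempotentElem p) (x y : E) :
    p * (p * x + (1 - p) * y) = p * x := by
  linear_combination (x - y) * hp.eq

theorem one_sub_mul_glue {p : E} (hp : IsIdempotentElem p) (x y : E) :
    (1 - p) * (p * x + (1 - p) * y) = (1 - p) * y := by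
  linear_combination (y - x) * hp.eq

variable [Algebra ℝ E]

theorem LocallyBandPreservingOn.neg {s : Set E} (hf : LocallyBandPreservingOn f s) :
    LocallyBandPreservingOn (fun x => -f x) s := fun P hP x hx y hy h => by
  rw [map_neg, map_neg, hf P hP x hx y hy h]

/-- Over the band of `p`, the supremum of `f` only depends on the interval over that band. -/
theorem LocallyBandPreservingOn.mul_sSup_le (hf : LocallyBandPreservingOn f (Set.Icc a b))
    (hb : OrderBoundedOn f (Set.Icc a b)) {p : E} (hp : IsIdempotentElem p) {x y u v : E}
    (hax : a ≤ x) (hxy : x ≤ y) (hyb : y ≤ b) (hau : a ≤ u) (huv : u ≤ v) (hvb : v ≤ b)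
    (hux : p * u ≤ p * x) (hyv : p * y ≤ p * v) :
    p * sSup (f '' Set.Icc x y) ≤ p * sSup (f '' Set.Icc u v) := by
  have hp0 := IsIdempotentElem.nonneg_of_isFAlgebra hp
  have hq0 := IsIdempotentElem.nonneg_of_isFAlgebra hp.one_sub
  set S := sSup (f '' Set.Icc x y) with hS
  set T := sSup (f '' Set.Icc u v) with hT
  have h : S ≤ p * T + (1 - p) * S := by
    refine sSup_image_le hxy fun z hz => ?_
    have hz' : p * z + (1 - p) * u ∈ Set.Icc u v :=
      mul_add_one_sub_mul_mem_Icc hp (hux.trans (mul_le_mul_of_nonneg_left hz.1 hp0))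
        ((mul_le_mul_of_nonneg_left hz.2 hp0).trans hyv) ⟨le_rfl, huv⟩
    have h1 := hf.mul_eq hp (⟨hau.trans hz'.1, hz'.2.trans hvb⟩ : _ ∈ Set.Icc a b)
      (⟨hax.trans hz.1, hz.2.trans hyb⟩ : z ∈ Set.Icc a b) (mul_glue hp z u)
    have h2 := mul_le_mul_of_nonneg_left (hb.le_sSup hau hvb hz') hp0
    have h3 := mul_le_mul_of_nonneg_left (hb.le_sSup hax hyb hz) hq0
    rw [h1] at h2
    linear_combination h2 + h3
  have h4 := mul_le_mul_of_nonneg_left h hp0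
  rwa [mul_glue hp] at h4

theorem LocallyBandPreservingOn.mul {s : Set E} (hf : LocallyBandPreservingOn f s)
    (hg : LocallyBandPreservingOn g s) : LocallyBandPreservingOn (fun x => f x * g x) s := by
  intro P hP x hx y hy h
  obtain ⟨p, hp, hPp⟩ := hP.exists_eq_mul
  rw [hPp, hPp] at h ⊢
  linear_combination (g x) * hf.mul_eq hp hx hy h + (f y) * hg.mul_eq hp hx hy h

theorem LocallyBandPreservingOn.add {s : Set E} (hf : LocallyBandPreservingOn f s)
    (hg : LocallyBandPreservingOn g s) : LocallyBandPreservingOn (fun x => f x + g x) s := by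
  intro P hP x hx y hy h
  rw [map_add, map_add, hf P hP x hx y hy h, hg P hP x hx y hy h]

end Functions

/-! ### Partitions and common refinements -/

section Partition

namespace Partition

section Lattice

variable {E : Type u} [Lattice E] {a b c : E}

theorem pts_mono (P : Partition a b) {i j : ℕ} (hij : i ≤ j) (hj : j ≤ P.n) :
    P.pts i ≤ P.pts j := by
  induction j, hij using Nat.le_induction with
  | base => exact le_rfl
  | succ k _ ih => exact (ih (by omega)).trans (P.le_succ k (by omega))

theorem left_le_pts (P : Partition a b) {i : ℕ} (hi : i ≤ P.n) : a ≤ P.pts i := by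
  conv_lhs => rw [← P.pts_zero]
  exact P.pts_mono i.zero_le hi

theorem pts_le_right (P : Partition a b) {i : ℕ} (hi : i ≤ P.n) : P.pts i ≤ b := by
  conv_rhs => rw [← P.pts_last]
  exact P.pts_mono hi le_rfl

/-- The partition with the single interval `[a, b]`. -/
def single (hab : a ≤ b) : Partition a b where
  n := 1
  pts i := if i = 0 then a else b
  pts_zero := rfl
  pts_last := rfl
  le_succ i hi := by obtain rfl : i = 0 := by omega
                     simpa using hab

/-- The concatenation of a partition of `[a, b]` and a partition of `[b, c]`. -/
def append (P : Partition a b) (Q : Partition b c) : Partition a c where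
  n := P.n + Q.n
  pts i := if i ≤ P.n then P.pts i else Q.pts (i - P.n)
  pts_zero := by simp [P.pts_zero]
  pts_last := by
    split_ifs with h
    · obtain hQ : Q.n = 0 := by omega
      have h1 := Q.pts_last
      rw [hQ, Q.pts_zero] at h1
      rw [hQ, add_zero, P.pts_last, h1]
    · rw [Nat.add_sub_cancel_left, Q.pts_last]
  le_succ i hi := by
    split_ifs with h1 h2 h2
    · exact P.le_succ i (by omega)
    · obtain rfl : i = P.n := by omega
      have := Q.le_succ 0 (by omega)
      rw [Q.pts_zero, zero_add] at this
      rwa [P.pts_last, Nat.add_sub_cancel_left]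
    · omega
    · rw [show i + 1 - P.n = i - P.n + 1 by omega]
      exact Q.le_succ _ (by omega)

/-- The truncation of `z` to the interval `[x, y]`. -/
def clampPt (x y z : E) : E := x ⊔ (z ⊓ y)

theorem clampPt_mono (x y : E) : Monotone (clampPt x y) := fun _ _ h =>
  sup_le_sup_left (inf_le_inf_right _ h) _

theorem left_le_clampPt (x y z : E) : x ≤ clampPt x y z := le_sup_left

theorem clampPt_le_right {x y : E} (hxy : x ≤ y) (z : E) : clampPt x y z ≤ y :=
  sup_le hxy inf_le_right

/-- The partition of `[x, y]` induced by a partition of a larger interval. -/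
def clamp (Q : Partition a b) {x y : E} (hax : a ≤ x) (hxy : x ≤ y) (hyb : y ≤ b) :
    Partition x y where
  n := Q.n
  pts j := clampPt x y (Q.pts j)
  pts_zero := by rw [Q.pts_zero]; exact sup_eq_left.2 (inf_le_left.trans hax)
  pts_last := by rw [Q.pts_last, clampPt, inf_eq_right.2 hyb]; exact sup_eq_right.2 hxy
  le_succ j hj := clampPt_mono x y (Q.le_succ j hj)

end Lattice

section Sums

variable {E : Type u} [CommRing E] [ConditionallyCompleteLattice E] {a b c : E}

theorem upperSum_append (f : E → E) (P : Partition a b) (Q : Partition b c) :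
    upperSum f (P.append Q) = upperSum f P + upperSum f Q := by
  unfold upperSum append
  simp only
  rw [Finset.sum_range_add]
  congr 1
  · refine Finset.sum_congr rfl fun i hi => ?_
    have hi := Finset.mem_range.1 hi
    rw [if_pos (by omega), if_pos (by omega)]
  · refine Finset.sum_congr rfl fun i hi => ?_
    rw [if_neg (show ¬P.n + i + 1 ≤ P.n by omega), add_assoc, Nat.add_sub_cancel_left]
    rcases i.eq_zero_or_pos with rfl | h
    · simp [P.pts_last, Q.pts_zero]
    · rw [if_neg (by omega), Nat.add_sub_cancel_left]

/-- The partition obtained by subdividing each interval of `P` by the points of `Q`. -/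
theorem exists_upperSum_eq_sum (P Q : Partition a b) :
    ∃ R : Partition a b, ∀ f : E → E, upperSum f R =
      ∑ i ∈ Finset.range P.n, ∑ j ∈ Finset.range Q.n,
        sSup (f '' Set.Icc (clampPt (P.pts i) (P.pts (i + 1)) (Q.pts j))
          (clampPt (P.pts i) (P.pts (i + 1)) (Q.pts (j + 1)))) *
        (clampPt (P.pts i) (P.pts (i + 1)) (Q.pts (j + 1)) -
          clampPt (P.pts i) (P.pts (i + 1)) (Q.pts j)) := by
  have key : ∀ k ≤ P.n, ∃ R : Partition a (P.pts k), ∀ f : E → E, upperSum f R =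
      ∑ i ∈ Finset.range k, ∑ j ∈ Finset.range Q.n,
        sSup (f '' Set.Icc (clampPt (P.pts i) (P.pts (i + 1)) (Q.pts j))
          (clampPt (P.pts i) (P.pts (i + 1)) (Q.pts (j + 1)))) *
        (clampPt (P.pts i) (P.pts (i + 1)) (Q.pts (j + 1)) -
          clampPt (P.pts i) (P.pts (i + 1)) (Q.pts j)) := by
    intro k
    induction k with
    | zero =>
      exact fun _ => ⟨⟨0, fun _ => a, rfl, P.pts_zero.symm, by simp⟩, fun f => by simp [upperSum]⟩
    | succ k ih =>
      intro hk
      obtain ⟨R, hR⟩ := ih (by omega)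
      refine ⟨R.append (Q.clamp (P.left_le_pts (by omega)) (P.le_succ k hk)
        (P.pts_le_right hk)), fun f => ?_⟩
      rw [upperSum_append, hR, Finset.sum_range_succ]
      rfl
  obtain ⟨R, hR⟩ := key P.n le_rfl
  have hcast : ∀ b' : E, P.pts P.n = b' → ∃ R' : Partition a b', ∀ f : E → E,
      upperSum f R' = upperSum f R := by
    rintro _ rfl; exact ⟨R, fun _ => rfl⟩
  obtain ⟨R', hR'⟩ := hcast b P.pts_last
  exact ⟨R', fun f => (hR' f).trans (hR f)⟩

end Sums

section Refine

variable {E : Type u} [CommRing E] [ConditionallyCompleteLattice E] [IsOrderedAddMonoid E]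
  [IsFAlgebra E] {a b : E} {f : E → E}

/-- This form is symmetric in the roles of the two partitions when clamped points are differenced, and
telescopes in either index. -/
theorem clampPt_sub_left {x y : E} (hxy : x ≤ y) (z : E) :
    clampPt x y z - x = z ⊓ y - z ⊓ x := by
  have h := inf_add_sup x (z ⊓ y)
  rw [inf_left_comm, inf_eq_left.2 hxy] at h
  rw [clampPt]
  linear_combination h

variable [Algebra ℝ E] [PosSMulMono ℝ E]

/-- Where the truncations of `z ≤ w` to `[x, y]` differ, the interval they bound lies in `[z, w]`. -/
theorem exists_carrier_clampPt {x y z w : E} (hxy : x ≤ y) (hzw : z ≤ w) :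
    ∃ p : E, IsIdempotentElem p ∧
      p * (clampPt x y w - clampPt x y z) = clampPt x y w - clampPt x y z ∧
      p * z ≤ p * clampPt x y z ∧ p * clampPt x y w ≤ p * w := by
  have hl : 0 ≤ clampPt x y w - clampPt x y z := sub_nonneg.2 (clampPt_mono x y hzw)
  obtain ⟨p, hp, h1, h2⟩ := exists_carrier hl
  have hp0 := IsIdempotentElem.nonneg_of_isFAlgebra hp
  have key : ∀ u v : E, (clampPt x y w - clampPt x y z) ⊓ (u - u ⊓ v) ≤ 0 → p * u ≤ p * v := by
    intro u v h
    have huv : 0 ≤ u - u ⊓ v := sub_nonneg.2 inf_le_left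
    have h3 := h2 _ (mul_eq_zero_of_inf_eq_zero (le_antisymm h (le_inf hl huv)))
    rw [mul_sub, sub_eq_zero] at h3
    rw [h3]
    exact mul_le_mul_of_nonneg_left inf_le_right hp0
  refine ⟨p, hp, h1, key _ _ ?_, key _ _ ?_⟩
  · rw [← sub_inf_inf_sub_inf y z]
    refine inf_le_inf (sub_le_sub (clampPt_le_right hxy w) ?_) (sub_le_sub_left ?_ z)
    · rw [inf_comm]; exact le_sup_right
    · rw [inf_comm]; exact le_inf inf_le_left le_sup_right
  · rw [← sub_inf_inf_sub_inf w x]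
    have h3 : clampPt x y w ≤ x ⊔ w := sup_le_sup_left inf_le_left x
    have h4 := inf_add_sup w x
    have h5 := inf_add_sup (clampPt x y w) w
    have h6 : clampPt x y w ⊔ w ≤ w ⊔ x := sup_le (h3.trans_eq (sup_comm _ _)) le_sup_left
    refine inf_le_inf ?_ ?_
    · rw [sup_comm] at h3
      linear_combination h3 + left_le_clampPt x y z + h4
    · linear_combination h6 + h4 - h5

/-- The partition `R` obtained by subdividing `P` by the points of `Q`. It also serves as a
refinement of `Q`, because a piece of `R` matters only on the band generated by its length, and
over that band it lies in an interval of `Q`. -/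
theorem exists_upperSum_le (P Q : Partition a b) :
    ∃ R : Partition a b, ∀ f : E → E, LocallyBandPreservingOn f (Set.Icc a b) →
      OrderBoundedOn f (Set.Icc a b) → upperSum f R ≤ upperSum f P ∧ upperSum f R ≤ upperSum f Q := by
  obtain ⟨R, hR⟩ := exists_upperSum_eq_sum P Q
  refine ⟨R, fun f hf hb => ?_⟩
  rw [hR]
  have hP : ∀ i < P.n, P.pts i ≤ P.pts (i + 1) := P.le_succ
  have hlen : ∀ i < P.n, ∀ j < Q.n, 0 ≤ clampPt (P.pts i) (P.pts (i + 1)) (Q.pts (j + 1)) -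
      clampPt (P.pts i) (P.pts (i + 1)) (Q.pts j) := fun i _ j hj =>
    sub_nonneg.2 (clampPt_mono _ _ (Q.le_succ j hj))
  constructor
  · refine Finset.sum_le_sum fun i hi => ?_
    have hi := Finset.mem_range.1 hi
    have hsum : P.pts (i + 1) - P.pts i = ∑ j ∈ Finset.range Q.n,
        (clampPt (P.pts i) (P.pts (i + 1)) (Q.pts (j + 1)) -
          clampPt (P.pts i) (P.pts (i + 1)) (Q.pts j)) := by
      let C := Q.clamp (P.left_le_pts hi.le) (hP i hi) (P.pts_le_right hi)
      rw [Finset.sum_range_sub (fun j => clampPt (P.pts i) (P.pts (i + 1)) (Q.pts j))]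
      exact congr_arg₂ _ C.pts_last.symm C.pts_zero.symm
    rw [hsum, Finset.mul_sum]
    refine Finset.sum_le_sum fun j hj => ?_
    have hj := Finset.mem_range.1 hj
    refine mul_le_mul_of_nonneg_right ?_ (hlen i hi j hj)
    refine sSup_image_le (clampPt_mono _ _ (Q.le_succ j hj)) fun z hz => ?_
    exact hb.le_sSup (P.left_le_pts hi.le) (P.pts_le_right hi)
      ⟨(left_le_clampPt _ _ _).trans hz.1, hz.2.trans (clampPt_le_right (hP i hi) _)⟩
  · rw [Finset.sum_comm]
    refine Finset.sum_le_sum fun j hj => ?_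
    have hj := Finset.mem_range.1 hj
    have hsum : Q.pts (j + 1) - Q.pts j = ∑ i ∈ Finset.range P.n,
        (clampPt (P.pts i) (P.pts (i + 1)) (Q.pts (j + 1)) -
          clampPt (P.pts i) (P.pts (i + 1)) (Q.pts j)) := by
      have h1 : ∀ i ∈ Finset.range P.n, clampPt (P.pts i) (P.pts (i + 1)) (Q.pts (j + 1)) -
          clampPt (P.pts i) (P.pts (i + 1)) (Q.pts j) =
          (Q.pts (j + 1) ⊓ P.pts (i + 1) - Q.pts j ⊓ P.pts (i + 1)) -
            (Q.pts (j + 1) ⊓ P.pts i - Q.pts j ⊓ P.pts i) := fun i hi => by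
        have hi := hP i (Finset.mem_range.1 hi)
        linear_combination clampPt_sub_left hi (Q.pts (j + 1)) - clampPt_sub_left hi (Q.pts j)
      rw [Finset.sum_congr rfl h1,
        Finset.sum_range_sub (fun i => Q.pts (j + 1) ⊓ P.pts i - Q.pts j ⊓ P.pts i),
        P.pts_last, P.pts_zero, inf_eq_left.2 (Q.pts_le_right hj),
        inf_eq_left.2 (Q.pts_le_right hj.le), inf_eq_right.2 (Q.left_le_pts hj),
        inf_eq_right.2 (Q.left_le_pts hj.le), sub_self, sub_zero]
    rw [hsum, Finset.mul_sum]
    refine Finset.sum_le_sum fun i hi => ?_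
    have hi := Finset.mem_range.1 hi
    obtain ⟨p, hp, h1, h2, h3⟩ := exists_carrier_clampPt (hP i hi) (Q.le_succ j hj)
    have h4 := hf.mul_sSup_le hb hp ((P.left_le_pts hi.le).trans (left_le_clampPt _ _ _))
      (clampPt_mono _ _ (Q.le_succ j hj))
      ((clampPt_le_right (hP i hi) _).trans (P.pts_le_right hi)) (Q.left_le_pts hj.le)
      (Q.le_succ j hj) (Q.pts_le_right hj) h2 h3
    have h5 := mul_le_mul_of_nonneg_right h4 (hlen i hi j hj)
    rwa [mul_comm p, mul_comm p, mul_assoc, h1, mul_assoc, h1] at h5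

end Refine

end Partition

end Partition

/-! ### Darboux sums and integrability -/

section Integrability

variable {E : Type u} [CommRing E] [ConditionallyCompleteLattice E] [IsOrderedAddMonoid E]
  [IsFAlgebra E] {a b : E} {f g : E → E}

theorem lowerSum_eq_neg_upperSum_neg (hb : OrderBoundedOn f (Set.Icc a b)) (P : Partition a b) :
    lowerSum f P = -upperSum (fun x => -f x) P := by
  rw [lowerSum, upperSum, ← Finset.sum_neg_distrib]
  refine Finset.sum_congr rfl fun i hi => ?_
  have hi := Finset.mem_range.1 hi
  rw [hb.sInf_eq_neg (P.left_le_pts hi.le) (P.le_succ i hi) (P.pts_le_right hi), neg_mul]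

theorem lowerSum_le_upperSum_self (hb : OrderBoundedOn f (Set.Icc a b)) (P : Partition a b) :
    lowerSum f P ≤ upperSum f P := by
  refine Finset.sum_le_sum fun i hi => ?_
  have hi := Finset.mem_range.1 hi
  refine mul_le_mul_of_nonneg_right ?_ (sub_nonneg.2 (P.le_succ i hi))
  have hmem : P.pts i ∈ Set.Icc (P.pts i) (P.pts (i + 1)) := ⟨le_rfl, P.le_succ i hi⟩
  exact (hb.sInf_le (P.left_le_pts hi.le) (P.pts_le_right hi) hmem).trans
    (hb.le_sSup (P.left_le_pts hi.le) (P.pts_le_right hi) hmem)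

/-- On an interval, the oscillation of a product is controlled by the oscillations of its factors. -/
theorem sSup_sub_sInf_mul_le (hf : OrderBoundedOn f (Set.Icc a b))
    (hg : OrderBoundedOn g (Set.Icc a b)) {K M : E} (hfK : ∀ x ∈ Set.Icc a b, |f x| ≤ K)
    (hgM : ∀ x ∈ Set.Icc a b, |g x| ≤ M) {x y : E} (hax : a ≤ x) (hxy : x ≤ y) (hyb : y ≤ b) :
    sSup ((fun z => f z * g z) '' Set.Icc x y) - sInf ((fun z => f z * g z) '' Set.Icc x y) ≤
      M * (sSup (f '' Set.Icc x y) - sInf (f '' Set.Icc x y)) +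
        K * (sSup (g '' Set.Icc x y) - sInf (g '' Set.Icc x y)) := by
  have hosc : ∀ {h : E → E}, OrderBoundedOn h (Set.Icc a b) → ∀ z ∈ Set.Icc x y,
      ∀ w ∈ Set.Icc x y, |h z - h w| ≤ sSup (h '' Set.Icc x y) - sInf (h '' Set.Icc x y) := by
    intro h hh z hz w hw
    refine abs_le'.2 ⟨sub_le_sub (hh.le_sSup hax hyb hz) (hh.sInf_le hax hyb hw), ?_⟩
    rw [neg_sub]
    exact sub_le_sub (hh.le_sSup hax hyb hw) (hh.sInf_le hax hyb hz)
  have hmem : ∀ z ∈ Set.Icc x y, z ∈ Set.Icc a b := fun z hz => ⟨hax.trans hz.1, hz.2.trans hyb⟩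
  set C := M * (sSup (f '' Set.Icc x y) - sInf (f '' Set.Icc x y)) +
        K * (sSup (g '' Set.Icc x y) - sInf (g '' Set.Icc x y))
  have h : ∀ z ∈ Set.Icc x y, ∀ w ∈ Set.Icc x y, f z * g z - C ≤ f w * g w := by
    intro z hz w hw
    have h1 : f z * g z - f w * g w = g z * (f z - f w) + f w * (g z - g w) := by ring
    have h2 : g z * (f z - f w) ≤ M * (sSup (f '' Set.Icc x y) - sInf (f '' Set.Icc x y)) :=
      (le_abs_self _).trans ((abs_mul_le_mul_abs _ _).trans (mul_le_mul (hgM z (hmem z hz))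
        (hosc hf z hz w hw) (abs_nonneg _) ((abs_nonneg _).trans (hgM z (hmem z hz)))))
    have h3 : f w * (g z - g w) ≤ K * (sSup (g '' Set.Icc x y) - sInf (g '' Set.Icc x y)) :=
      (le_abs_self _).trans ((abs_mul_le_mul_abs _ _).trans (mul_le_mul (hfK w (hmem w hw))
        (hosc hg z hz w hw) (abs_nonneg _) ((abs_nonneg _).trans (hfK w (hmem w hw)))))
    rw [sub_le_comm, h1]
    exact add_le_add h2 h3
  rw [sub_le_iff_le_add]
  refine sSup_image_le hxy fun z hz => ?_
  have := le_sInf_image hxy (f := fun z => f z * g z) fun w hw => h z hz w hw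
  rwa [sub_le_iff_le_add'] at this

theorem upperSum_sub_lowerSum_mul_le (hf : OrderBoundedOn f (Set.Icc a b))
    (hg : OrderBoundedOn g (Set.Icc a b)) {K M : E} (hfK : ∀ x ∈ Set.Icc a b, |f x| ≤ K)
    (hgM : ∀ x ∈ Set.Icc a b, |g x| ≤ M) (P : Partition a b) :
    upperSum (fun x => f x * g x) P - lowerSum (fun x => f x * g x) P ≤
      M * (upperSum f P - lowerSum f P) + K * (upperSum g P - lowerSum g P) := by
  simp only [upperSum, lowerSum]
  rw [← Finset.sum_sub_distrib, ← Finset.sum_sub_distrib, ← Finset.sum_sub_distrib,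
    Finset.mul_sum, Finset.mul_sum, ← Finset.sum_add_distrib]
  refine Finset.sum_le_sum fun i hi => ?_
  have hi := Finset.mem_range.1 hi
  have h := mul_le_mul_of_nonneg_right (sSup_sub_sInf_mul_le hf hg hfK hgM (P.left_le_pts hi.le)
    (P.le_succ i hi) (P.pts_le_right hi)) (sub_nonneg.2 (P.le_succ i hi))
  linear_combination h

variable [Algebra ℝ E] [PosSMulMono ℝ E]

/-- A common refinement of two partitions, valid for all bounded locally band preserving functions. -/
theorem exists_refinement (P Q : Partition a b) :
    ∃ R : Partition a b, ∀ f : E → E, LocallyBandPreservingOn f (Set.Icc a b) →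
      OrderBoundedOn f (Set.Icc a b) →
        upperSum f R ≤ upperSum f P ∧ upperSum f R ≤ upperSum f Q ∧
          lowerSum f P ≤ lowerSum f R ∧ lowerSum f Q ≤ lowerSum f R := by
  obtain ⟨R, hR⟩ := Partition.exists_upperSum_le P Q
  refine ⟨R, fun f hf hb => ?_⟩
  simp only [lowerSum_eq_neg_upperSum_neg hb, neg_le_neg_iff]
  exact ⟨(hR f hf hb).1, (hR f hf hb).2, (hR _ hf.neg hb.neg).1, (hR _ hf.neg hb.neg).2⟩

theorem lowerSum_le_upperSum (hf : LocallyBandPreservingOn f (Set.Icc a b))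
    (hb : OrderBoundedOn f (Set.Icc a b)) (P Q : Partition a b) :
    lowerSum f P ≤ upperSum f Q := by
  obtain ⟨R, hR⟩ := exists_refinement P Q
  obtain ⟨_, h1, h2, _⟩ := hR f hf hb
  exact h2.trans ((lowerSum_le_upperSum_self hb R).trans h1)

theorem isGLB_upperIntegral (hab : a ≤ b) (hf : LocallyBandPreservingOn f (Set.Icc a b))
    (hb : OrderBoundedOn f (Set.Icc a b)) :
    IsGLB (Set.range fun P : Partition a b => upperSum f P) (upperIntegral f a b) :=
  isGLB_csInf ⟨_, .single hab, rfl⟩ ⟨lowerSum f (.single hab), by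
    rintro _ ⟨Q, rfl⟩; exact lowerSum_le_upperSum hf hb _ Q⟩

theorem isLUB_lowerIntegral (hab : a ≤ b) (hf : LocallyBandPreservingOn f (Set.Icc a b))
    (hb : OrderBoundedOn f (Set.Icc a b)) :
    IsLUB (Set.range fun P : Partition a b => lowerSum f P) (lowerIntegral f a b) :=
  isLUB_csSup ⟨_, .single hab, rfl⟩ ⟨upperSum f (.single hab), by
    rintro _ ⟨Q, rfl⟩; exact lowerSum_le_upperSum hf hb Q _⟩

theorem darbouxIntegrable_iff_isGLB (hab : a ≤ b) (hf : LocallyBandPreservingOn f (Set.Icc a b))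
    (hb : OrderBoundedOn f (Set.Icc a b)) :
    DarbouxIntegrable f a b ↔
      IsGLB (Set.range fun P : Partition a b => upperSum f P - lowerSum f P) 0 := by
  have hU := isGLB_upperIntegral hab hf hb
  have hL := isLUB_lowerIntegral hab hf hb
  refine ⟨fun h => ⟨?_, fun w hw => ?_⟩, fun h => ⟨hb, le_antisymm ?_ ?_⟩⟩
  · rintro _ ⟨P, rfl⟩
    exact sub_nonneg.2 (lowerSum_le_upperSum_self hb P)
  · have h1 : ∀ P Q : Partition a b, w ≤ upperSum f P - lowerSum f Q := fun P Q => by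
      obtain ⟨R, hR⟩ := exists_refinement P Q
      obtain ⟨h1, _, _, h2⟩ := hR f hf hb
      exact (hw ⟨R, rfl⟩).trans (sub_le_sub h1 h2)
    have h2 : ∀ Q : Partition a b, w + lowerSum f Q ≤ upperIntegral f a b := fun Q => hU.2 (by
      rintro _ ⟨P, rfl⟩; exact le_sub_iff_add_le.1 (h1 P Q))
    have h3 : lowerIntegral f a b ≤ upperIntegral f a b - w := hL.2 (by
      rintro _ ⟨Q, rfl⟩; exact le_sub_iff_add_le'.2 (h2 Q))
    rw [h.2] at h3
    simpa using h3
  · rw [← sub_nonpos]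
    refine h.2 ?_
    rintro _ ⟨P, rfl⟩
    exact sub_le_sub (hU.1 ⟨P, rfl⟩) (hL.1 ⟨P, rfl⟩)
  · refine hL.2 ?_
    rintro _ ⟨P, rfl⟩
    refine hU.2 ?_
    rintro _ ⟨Q, rfl⟩
    exact lowerSum_le_upperSum hf hb P Q

theorem DarbouxIntegrable.mul (hfi : DarbouxIntegrable f a b) (hab : a ≤ b)
    (hf : LocallyBandPreservingOn f (Set.Icc a b))
    (hg : LocallyBandPreservingOn g (Set.Icc a b))
    (hgi : DarbouxIntegrable g a b) : DarbouxIntegrable (fun x => f x * g x) a b := by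
  have hb := hfi.1.mul hgi.1
  obtain ⟨K, hK, hfK⟩ := hfi.1.exists_abs_le
  obtain ⟨M, hM, hgM⟩ := hgi.1.exists_abs_le
  rw [darbouxIntegrable_iff_isGLB hab (hf.mul hg) hb]
  refine ⟨?_, fun w hw => ?_⟩
  · rintro _ ⟨P, rfl⟩
    exact sub_nonneg.2 (lowerSum_le_upperSum_self hb P)
  · have h1 : ∀ P Q : Partition a b,
        w ≤ M * (upperSum f P - lowerSum f P) + K * (upperSum g Q - lowerSum g Q) := fun P Q => by
      obtain ⟨R, hR⟩ := exists_refinement P Q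
      obtain ⟨h1, _, h2, _⟩ := hR f hf hfi.1
      obtain ⟨_, h3, _, h4⟩ := hR g hg hgi.1
      refine (hw ⟨R, rfl⟩).trans
        ((upperSum_sub_lowerSum_mul_le hfi.1 hgi.1 hfK hgM R).trans (add_le_add ?_ ?_))
      · exact mul_le_mul_of_nonneg_left (sub_le_sub h1 h2) hM
      · exact mul_le_mul_of_nonneg_left (sub_le_sub h3 h4) hK
    refine nonpos_of_forall_le_mul ((darbouxIntegrable_iff_isGLB hab hf hfi.1).1 hfi) hM ?_
    rintro _ ⟨P, rfl⟩
    rw [← sub_nonpos]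
    refine nonpos_of_forall_le_mul ((darbouxIntegrable_iff_isGLB hab hg hgi.1).1 hgi) hK ?_
    rintro _ ⟨Q, rfl⟩
    exact sub_le_iff_le_add'.2 (h1 P Q)

end Integrability

/-! ### Order continuous and order differentiable functions -/

section Calculus

variable {E : Type u} [CommRing E] [ConditionallyCompleteLattice E] [IsOrderedAddMonoid E]
  [IsFAlgebra E] {s : Set E} {f g : E → E} {c d d₁ d₂ : E}

theorem OrderContinuousOn.neg (hf : OrderContinuousOn f s) :
    OrderContinuousOn (fun x => -f x) s := by
  intro c hc ι _ _ _ x hx hxc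
  obtain ⟨Eps, hE, h⟩ := hf c hc ι x hx hxc
  refine ⟨Eps, hE, fun ε hε => (h ε hε).imp fun α₀ h α hα => ?_⟩
  rw [← neg_sub', abs_neg]
  exact h α hα

theorem HasOrderDerivAt.neg (hf : HasOrderDerivAt f s d c) :
    HasOrderDerivAt (fun x => -f x) s (-d) c := by
  obtain ⟨r, hr, hrs, h⟩ := hf
  refine ⟨r, hr, hrs, fun Δ hΔ => ?_⟩
  obtain ⟨Eps, hE, h⟩ := h Δ hΔ
  refine ⟨Eps, hE, fun ε hε => ?_⟩
  obtain ⟨δ, hδ, h⟩ := h ε hε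
  refine ⟨δ, hδ, fun x hx hxδ => ?_⟩
  rw [show -f x - -f c - (x - c) * -d = -(f x - f c - (x - c) * d) by ring, abs_neg]
  exact h x hx hxδ

variable [Algebra ℝ E] [PosSMulMono ℝ E]

theorem OrderContinuousOn.mul (hg : OrderContinuousOn g s) (hf : OrderContinuousOn f s) {K : E}
    (hK : ∀ x ∈ s, |f x| ≤ K) : OrderContinuousOn (fun x => f x * g x) s := by
  intro c hc ι _ _ _ x hx hxc
  obtain ⟨Ef, hEf, hf⟩ := hf c hc ι x hx hxc
  obtain ⟨Eg, hEg, hg⟩ := hg c hc ι x hx hxc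
  have hK0 : 0 ≤ K := (abs_nonneg _).trans (hK c hc)
  refine ⟨{e | ∃ ε₁ ∈ Ef, ∃ ε₂ ∈ Eg, e = |g c| * ε₁ + K * ε₂}, ⟨?_, fun w hw => ?_⟩, ?_⟩
  · rintro _ ⟨ε₁, h1, ε₂, h2, rfl⟩
    exact add_nonneg (mul_nonneg (abs_nonneg _) (hEf.1 h1)) (mul_nonneg hK0 (hEg.1 h2))
  · refine nonpos_of_forall_le_mul hEf (abs_nonneg (g c)) fun ε₁ h1 => ?_
    rw [← sub_nonpos]
    refine nonpos_of_forall_le_mul hEg hK0 fun ε₂ h2 => ?_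
    exact sub_le_iff_le_add'.2 (hw ⟨ε₁, h1, ε₂, h2, rfl⟩)
  · rintro _ ⟨ε₁, h1, ε₂, h2, rfl⟩
    obtain ⟨α₁, hα₁⟩ := hf ε₁ h1
    obtain ⟨α₂, hα₂⟩ := hg ε₂ h2
    obtain ⟨α₀, h₁, h₂⟩ := exists_ge_ge α₁ α₂
    refine ⟨α₀, fun α hα => ?_⟩
    rw [show f (x α) * g (x α) - f c * g c =
      g c * (f (x α) - f c) + f (x α) * (g (x α) - g c) by ring]
    refine (abs_add_le _ _).trans (add_le_add ?_ ?_)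
    · exact (abs_mul_le_mul_abs _ _).trans
        (mul_le_mul_of_nonneg_left (hα₁ α (h₁.trans hα)) (abs_nonneg _))
    · exact (abs_mul_le_mul_abs _ _).trans
        (mul_le_mul (hK _ (hx α)) (hα₂ α (h₂.trans hα)) (abs_nonneg _) hK0)

/-- The product rule. The error of `f g` is `|x - c|` times a bound of the form
`M ε₁ + |f c| ε₂ + |d₁| (|d₂| + ε₂) δ`. -/
theorem HasOrderDerivAt.mul (hf : HasOrderDerivAt f s d₁ c) (hg : HasOrderDerivAt g s d₂ c) {M : E}
    (hM0 : 0 ≤ M) (hM : ∀ x ∈ s, |g x| ≤ M) :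
    HasOrderDerivAt (fun x => f x * g x) s (f c * d₂ + d₁ * g c) c := by
  obtain ⟨r₁, hr₁, hs₁, hf⟩ := hf
  obtain ⟨r₂, hr₂, hs₂, hg⟩ := hg
  have hsub : ∀ {r : E}, r₁ ⊓ r₂ ≤ r →
      openInterval (c - r₁ ⊓ r₂) (c + r₁ ⊓ r₂) ⊆ openInterval (c - r) (c + r) :=
    fun {r} h x hx => ⟨hx.1.mono (by linear_combination h), hx.2.mono (by linear_combination h)⟩
  refine ⟨r₁ ⊓ r₂, ?_, (hsub inf_le_left).trans hs₁, fun Δ hΔ => ?_⟩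
  · rw [WayLT, sub_zero] at *
    exact hr₁.inf hr₂
  obtain ⟨Ef, hEf, hf⟩ := hf Δ hΔ
  obtain ⟨Eg, hEg, hg⟩ := hg Δ hΔ
  have hg0 : ∀ {ε₂}, ε₂ ∈ Eg → 0 ≤ |d₁| * (|d₂| + ε₂) := fun h =>
    mul_nonneg (abs_nonneg _) (add_nonneg (abs_nonneg _) (hEg.1 h))
  refine ⟨{e | ∃ ε₁ ∈ Ef, ∃ ε₂ ∈ Eg, ∃ δ ∈ Δ,
    e = M * ε₁ + (|f c| * ε₂ + |d₁| * (|d₂| + ε₂) * δ)}, ⟨?_, fun w hw => ?_⟩, ?_⟩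
  · rintro _ ⟨ε₁, h1, ε₂, h2, δ, h3, rfl⟩
    exact add_nonneg (mul_nonneg hM0 (hEf.1 h1)) (add_nonneg
      (mul_nonneg (abs_nonneg _) (hEg.1 h2)) (mul_nonneg (hg0 h2) (hΔ.2.2.1 h3)))
  · refine nonpos_of_forall_le_mul hEf hM0 fun ε₁ h1 => ?_
    rw [← sub_nonpos]
    refine nonpos_of_forall_le_mul hEg (abs_nonneg (f c)) fun ε₂ h2 => ?_
    rw [← sub_nonpos]
    refine nonpos_of_forall_le_mul hΔ.2.2 (hg0 h2) fun δ h3 => ?_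
    exact sub_le_iff_le_add'.2 (sub_le_iff_le_add'.2 (hw ⟨ε₁, h1, ε₂, h2, δ, h3, rfl⟩))
  · rintro _ ⟨ε₁, h1, ε₂, h2, δ₃, h3, rfl⟩
    obtain ⟨δ₁, hδ₁, hf⟩ := hf ε₁ h1
    obtain ⟨δ₂, hδ₂, hg⟩ := hg ε₂ h2
    obtain ⟨δ₄, hδ₄, h41, h42⟩ := hΔ.2.1 δ₁ hδ₁ δ₂ hδ₂
    obtain ⟨δ, hδ, h54, h53⟩ := hΔ.2.1 δ₄ hδ₄ δ₃ h3
    refine ⟨δ, hδ, fun x hx hxδ => ?_⟩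
    have hf := hf x (hsub inf_le_left hx) (hxδ.trans (h54.trans h41))
    have hg := hg x (hsub inf_le_right hx) (hxδ.trans (h54.trans h42))
    have hgx := hM x (hs₁ (hsub inf_le_left hx))
    have hxc := abs_nonneg (x - c)
    have hgc : |g x - g c| ≤ |x - c| * (|d₂| + ε₂) := by
      rw [show g x - g c = (x - c) * d₂ + (g x - g c - (x - c) * d₂) by ring, mul_add]
      exact (abs_add_le _ _).trans (add_le_add (abs_mul_le_mul_abs _ _) hg)
    rw [show f x * g x - f c * g c - (x - c) * (f c * d₂ + d₁ * g c) =
      g x * (f x - f c - (x - c) * d₁) + (f c * (g x - g c - (x - c) * d₂) +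
        (x - c) * d₁ * (g x - g c)) by ring]
    have e1 : |g x * (f x - f c - (x - c) * d₁)| ≤ M * (|x - c| * ε₁) :=
      (abs_mul_le_mul_abs _ _).trans (mul_le_mul hgx hf (abs_nonneg _) hM0)
    have e2 : |f c * (g x - g c - (x - c) * d₂)| ≤ |f c| * (|x - c| * ε₂) :=
      (abs_mul_le_mul_abs _ _).trans (mul_le_mul_of_nonneg_left hg (abs_nonneg _))
    have e3 : |(x - c) * d₁ * (g x - g c)| ≤ |x - c| * |d₁| * (δ₃ * (|d₂| + ε₂)) := by
      refine (abs_mul_le_mul_abs _ _).trans (mul_le_mul (abs_mul_le_mul_abs _ _) ?_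
        (abs_nonneg _) (mul_nonneg hxc (abs_nonneg _)))
      exact hgc.trans (mul_le_mul_of_nonneg_right (hxδ.trans h53)
        (add_nonneg (abs_nonneg _) (hEg.1 h2)))
    refine (abs_add_le _ _).trans ?_
    linear_combination abs_add_le (f c * (g x - g c - (x - c) * d₂)) ((x - c) * d₁ * (g x - g c)) +
      e1 + e2 + e3

/-! ### The mean value inequality -/

theorem half_pow_antitone : Antitone fun n : ℕ => half E ^ n := fun _ _ h =>
  pow_le_pow_of_le_one (half_nonneg E) (half_le_one E) h

theorem decreasesToZero_half_pow_mul {l : E} (hl : 0 ≤ l) :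
    DecreasesToZero (Set.range fun n : ℕ => half E ^ n * l) := by
  have hanti : ∀ {m n : ℕ}, m ≤ n → half E ^ n * l ≤ half E ^ m * l := fun h =>
    mul_le_mul_of_nonneg_right (half_pow_antitone h) hl
  refine ⟨Set.range_nonempty _, ?_, ?_, fun w hw => ?_⟩
  · rintro _ ⟨m, rfl⟩ _ ⟨n, rfl⟩
    exact ⟨_, ⟨max m n, rfl⟩, hanti (le_max_left _ _), hanti (le_max_right _ _)⟩
  · rintro _ ⟨n, rfl⟩
    exact mul_nonneg (half_pow_nonneg E n) hl
  · exact nonpos_of_forall_le_half_pow_mul fun n => hw ⟨n, rfl⟩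

/-- Order continuity along a sequence converging at the rate `2⁻ⁿ l`. -/
theorem OrderContinuousOn.exists_abs_sub_le (hf : OrderContinuousOn f s) (hc : c ∈ s) {z : ℕ → E}
    (hz : ∀ n, z n ∈ s) {l : E} (hl : 0 ≤ l) (hzc : ∀ n, |z n - c| ≤ half E ^ n * l) :
    ∃ Eps : Set E, IsGLB Eps 0 ∧ ∀ ε ∈ Eps, ∃ N, ∀ n, N ≤ n → |f (z n) - f c| ≤ ε := by
  obtain ⟨Eps, hE, h⟩ := hf c hc (ULift.{u} ℕ) (fun n => z n.down) (fun n => hz _)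
    ⟨_, (decreasesToZero_half_pow_mul hl).2.2, by
      rintro _ ⟨N, rfl⟩
      exact ⟨⟨N⟩, fun n hn => (hzc _).trans
        (mul_le_mul_of_nonneg_right (half_pow_antitone (ULift.down_le.2 hn)) hl)⟩⟩
  refine ⟨Eps, hE, fun ε hε => ?_⟩
  obtain ⟨N, hN⟩ := h ε hε
  exact ⟨N.down, fun n hn => hN ⟨n⟩ hn⟩

variable {a b : E}

/-- Difference quotients along intervals `[u n, v n]` that shrink to `c` are eventually no larger than
the derivative at `c`. Only points `x` with `c - r ≪ x ≪ c + r` are covered by differentiability, so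
`u n` and `v n` are first replaced by `c` outside the band of an idempotent `q` on which
`v m - u m ≤ r / 2`; these bands exhaust `E` as `m` grows, because `r` is a weak order unit. -/
theorem HasOrderDerivAt.nonpos_of_forall_le (hf : LocallyBandPreservingOn f (Set.Icc a b))
    (hd : HasOrderDerivAt f (Set.Icc a b) d c) {l : E} (hl : 0 ≤ l) {u v : ℕ → E}
    (hu : ∀ n, a ≤ u n) (hv : ∀ n, v n ≤ b) (huc : ∀ n, u n ≤ c) (hcv : ∀ n, c ≤ v n)
    (huv : ∀ n, v n - u n = half E ^ n * l) {w : E}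
    (hw : ∀ n, w ≤ 2 ^ n * (f (v n) - f (u n)) - l * d) : w ≤ 0 := by
  obtain ⟨r, hr, hrs, hd⟩ := hd
  rw [WayLT, sub_zero] at hr
  obtain ⟨Eps, hE, hd⟩ := hd _ (decreasesToZero_half_pow_mul hl)
  have hhr : IsWeakOrderUnit (half E * r) := (isWeakOrderUnit_half E).mul hr
  have hhalf := half_add_half E
  have key : ∀ m : ℕ, w⁺ * (half E * r) ≤ half E ^ m * (l * w⁺) := by
    intro m
    obtain ⟨q, hq, hq1, hq2⟩ := exists_idempotent_mul_le (half E * r) (half E ^ m * l)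
    have hq0 := IsIdempotentElem.nonneg_of_isFAlgebra hq
    have hqle := IsIdempotentElem.le_one_of_isFAlgebra hq
    have hp0 := IsIdempotentElem.nonneg_of_isFAlgebra hq.one_sub
    have hmem : ∀ n, m ≤ n → ∀ x, |x - c| ≤ half E ^ n * l →
        q * x + (1 - q) * c ∈ openInterval (c - r) (c + r) := by
      intro n hn x hx
      have h1 : |q * (x - c)| ≤ half E * r := by
        rw [← mul_abs_of_nonneg hq0]
        calc q * |x - c| ≤ q * (half E ^ m * l) := mul_le_mul_of_nonneg_left
              (hx.trans (mul_le_mul_of_nonneg_right (half_pow_antitone hn) hl)) hq0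
          _ ≤ q * (half E * r) := hq1
          _ ≤ half E * r := mul_le_of_le_one_left hhr.1 hqle
      obtain ⟨h2, h3⟩ := abs_le'.1 h1
      exact ⟨hhr.mono (by linear_combination h3 + r * hhalf),
        hhr.mono (by linear_combination h2 + r * hhalf)⟩
    -- the difference quotients over the band of `q`
    have hqw : q * w ≤ 0 := by
      refine nonpos_of_forall_le_mul hE (mul_nonneg hq0 hl) fun ε hε => ?_
      obtain ⟨_, ⟨N, rfl⟩, hN⟩ := hd ε hε
      obtain ⟨n, hmn, hNn⟩ : ∃ n, m ≤ n ∧ N ≤ n := ⟨max m N, le_max_left _ _, le_max_right _ _⟩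
      have hcu := sub_nonneg.2 (huc n)
      have hvc := sub_nonneg.2 (hcv n)
      have hmemI : ∀ {x}, |x - c| ≤ half E ^ n * l → |q * x + (1 - q) * c - c| ≤ half E ^ N * l := by
        intro x hx
        rw [show q * x + (1 - q) * c - c = q * (x - c) by ring, ← mul_abs_of_nonneg hq0]
        exact (mul_le_of_le_one_left (abs_nonneg _) hqle).trans
          (hx.trans (mul_le_mul_of_nonneg_right (half_pow_antitone hNn) hl))
      have hu1 : |u n - c| ≤ half E ^ n * l := by
        rw [abs_sub_comm, abs_of_nonneg hcu, ← huv]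
        exact sub_le_sub_right (hcv n) _
      have hv1 : |v n - c| ≤ half E ^ n * l := by
        rw [abs_of_nonneg hvc, ← huv]
        exact sub_le_sub_left (huc n) _
      have hu2 := (neg_le_abs _).trans (hN _ (hmem n hmn _ hu1) (hmemI hu1))
      have hv2 := (le_abs_self _).trans (hN _ (hmem n hmn _ hv1) (hmemI hv1))
      rw [show q * u n + (1 - q) * c - c = -(q * (c - u n)) by ring, abs_neg,
        abs_of_nonneg (mul_nonneg hq0 hcu)] at hu2
      rw [show q * v n + (1 - q) * c - c = q * (v n - c) by ring,
        abs_of_nonneg (mul_nonneg hq0 hvc)] at hv2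
      have hu3 := hf.mul_eq hq (hrs (hmem n hmn _ hu1)) ⟨hu n, (huc n).trans ((hcv n).trans (hv n))⟩
        (mul_glue hq (u n) c)
      have hv3 := hf.mul_eq hq (hrs (hmem n hmn _ hv1)) ⟨(hu n).trans ((huc n).trans (hcv n)), hv n⟩
        (mul_glue hq (v n) c)
      have h1 := mul_le_mul_of_nonneg_left (add_le_add hu2 hv2) hq0
      have h2 : q * (f (v n) - f (u n)) ≤ q * (half E ^ n * l) * (d + ε) := by
        linear_combination h1 - hv3 + hu3 + q * (d + ε) * huv n +
          (d + ε) * (v n - u n) * hq.eq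
      have h3 := mul_le_mul_of_nonneg_left h2 (pow_nonneg zero_le_two n : (0 : E) ≤ 2 ^ n)
      have h4 := mul_le_mul_of_nonneg_left (hw n) hq0
      linear_combination h3 + h4 + q * l * (d + ε) * two_pow_mul_half_pow E n
    rw [← posPart_eq_zero, ← mul_posPart_of_nonneg hq0] at hqw
    have h1 := mul_le_mul_of_nonneg_left hq2 (posPart_nonneg w)
    have h2 : (1 - q) * (half E ^ m * l) * w⁺ = half E ^ m * l * w⁺ := by
      linear_combination -(half E ^ m * l) * hqw
    linear_combination h1 + h2 + (half E * r) * hqw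
  have h0 := nonpos_of_forall_le_half_pow_mul key
  rw [← posPart_eq_zero]
  exact (isWeakOrderUnit_iff.1 hhr).2 _ (le_antisymm h0 (mul_nonneg (posPart_nonneg w) hhr.1))

/-- One bisection step: the better halves of `[u, v]` over complementary bands are glued into one
interval. -/
theorem LocallyBandPreservingOn.exists_bisection (hf : LocallyBandPreservingOn f (Set.Icc a b))
    (M : E) {u v : E} (hau : a ≤ u) (huv : u ≤ v) (hvb : v ≤ b) :
    ∃ u' v', u ≤ u' ∧ u' ≤ v' ∧ v' ≤ v ∧ v' - u' = half E * (v - u) ∧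
      f v - f u - (v - u) * M ≤ 2 * (f v' - f u' - (v' - u') * M) := by
  have hh := half_add_half E
  set m := half E * (u + v) with hm
  have hlen := mul_nonneg (half_nonneg E) (sub_nonneg.2 huv)
  have hum : u ≤ m := by linear_combination hlen - u * hh
  have hmv : m ≤ v := by linear_combination hlen + v * hh
  obtain ⟨p, hp, h1, h2⟩ := exists_idempotent_mul_le
    (f v - f m - (v - m) * M) (f m - f u - (m - u) * M)
  have hp0 := IsIdempotentElem.nonneg_of_isFAlgebra hp
  have hq0 := IsIdempotentElem.nonneg_of_isFAlgebra hp.one_sub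
  have hu'v' := add_le_add (mul_le_mul_of_nonneg_left hmv hp0) (mul_le_mul_of_nonneg_left hum hq0)
  have huu' : u ≤ p * m + (1 - p) * u := by
    linear_combination mul_le_mul_of_nonneg_left hum hp0
  have hvv' : p * v + (1 - p) * m ≤ v := by
    linear_combination mul_le_mul_of_nonneg_left hmv hq0
  have hmI : m ∈ Set.Icc a b := ⟨hau.trans hum, hmv.trans hvb⟩
  have huI : u ∈ Set.Icc a b := ⟨hau, huv.trans hvb⟩
  have hvI : v ∈ Set.Icc a b := ⟨hau.trans huv, hvb⟩
  have huI' : p * m + (1 - p) * u ∈ Set.Icc a b :=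
    ⟨hau.trans huu', hu'v'.trans (hvv'.trans hvb)⟩
  have hvI' : p * v + (1 - p) * m ∈ Set.Icc a b :=
    ⟨hau.trans (huu'.trans hu'v'), hvv'.trans hvb⟩
  have e1 := hf.mul_eq hp huI' hmI (mul_glue hp _ _)
  have e2 := hf.mul_eq hp.one_sub huI' huI (one_sub_mul_glue hp _ _)
  have e3 := hf.mul_eq hp hvI' hvI (mul_glue hp _ _)
  have e4 := hf.mul_eq hp.one_sub hvI' hmI (one_sub_mul_glue hp _ _)
  refine ⟨_, _, huu', hu'v', hvv', ?_, ?_⟩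
  · linear_combination (2 * p - 1) * hm - (p * u + p * v - u) * hh
  · linear_combination h1 + h2 - 2 * e3 - 2 * e4 + 2 * e1 + 2 * e2

/-- The mean value inequality inside `(a, b)`, by repeated bisection of `[x, y]`. The bound on `f'` is only
needed on the band generated by `y - x`. -/
theorem sub_le_mul_of_wayLT (hf : LocallyBandPreservingOn f (Set.Icc a b)) {f' : E → E}
    (hd : ∀ c ∈ openInterval a b, HasOrderDerivAt f (Set.Icc a b) (f' c) c) {x y M : E}
    (hax : WayLT a x) (hxy : x ≤ y) (hyb : WayLT y b)
    (hM : ∀ c ∈ Set.Icc x y, (y - x) * f' c ≤ (y - x) * M) : f y - f x ≤ (y - x) * M := by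
  have hax' : a ≤ x := sub_nonneg.1 hax.1
  have hyb' : y ≤ b := sub_nonneg.1 hyb.1
  -- the bisection step, made total so that it can be iterated
  have hstep : ∀ z : E × E, ∃ z' : E × E, a ≤ z.1 → z.1 ≤ z.2 → z.2 ≤ b →
      z.1 ≤ z'.1 ∧ z'.1 ≤ z'.2 ∧ z'.2 ≤ z.2 ∧ z'.2 - z'.1 = half E * (z.2 - z.1) ∧
        f z.2 - f z.1 - (z.2 - z.1) * M ≤ 2 * (f z'.2 - f z'.1 - (z'.2 - z'.1) * M) := by
    intro z
    by_cases h : a ≤ z.1 ∧ z.1 ≤ z.2 ∧ z.2 ≤ b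
    · obtain ⟨u', v', h⟩ := hf.exists_bisection M h.1 h.2.1 h.2.2
      exact ⟨(u', v'), fun _ _ _ => h⟩
    · exact ⟨z, fun h1 h2 h3 => (h ⟨h1, h2, h3⟩).elim⟩
  choose next hnext using hstep
  let z : ℕ → E × E := fun n => next^[n] (x, y)
  have hz : ∀ n, z (n + 1) = next (z n) := fun n => Function.iterate_succ_apply' next n (x, y)
  have hinv : ∀ n, x ≤ (z n).1 ∧ (z n).1 ≤ (z n).2 ∧ (z n).2 ≤ y ∧
      (z n).2 - (z n).1 = half E ^ n * (y - x) ∧ f y - f x - (y - x) * M ≤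
        2 ^ n * (f (z n).2 - f (z n).1 - ((z n).2 - (z n).1) * M) := by
    intro n
    induction n with
    | zero => exact ⟨le_rfl, hxy, le_rfl, by simp [z], by simp [z]⟩
    | succ n ih =>
      obtain ⟨i1, i2, i3, i4, i5⟩ := ih
      obtain ⟨j1, j2, j3, j4, j5⟩ := hnext (z n) (hax'.trans i1) i2 (i3.trans hyb')
      rw [← hz] at j1 j2 j3 j4 j5
      refine ⟨i1.trans j1, j2, j3.trans i3, ?_, i5.trans ?_⟩
      · rw [j4, i4, pow_succ']; ring
      · have := mul_le_mul_of_nonneg_left j5 (pow_nonneg zero_le_two n : (0 : E) ≤ 2 ^ n)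
        rwa [← mul_assoc, ← pow_succ] at this
  have hmono : Monotone fun n => (z n).1 := monotone_nat_of_le_succ fun n => by
    obtain ⟨i1, i2, i3, -⟩ := hinv n
    rw [hz]
    exact (hnext (z n) (hax'.trans i1) i2 (i3.trans hyb')).1
  have hanti : Antitone fun n => (z n).2 := antitone_nat_of_succ_le fun n => by
    obtain ⟨i1, i2, i3, -⟩ := hinv n
    rw [hz]
    exact (hnext (z n) (hax'.trans i1) i2 (i3.trans hyb')).2.2.1
  have hle : ∀ m n, (z m).1 ≤ (z n).2 := fun m n =>
    (hmono (le_max_left m n)).trans ((hinv _).2.1.trans (hanti (le_max_right m n)))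
  have huc : ∀ n, (z n).1 ≤ sSup (Set.range fun n => (z n).1) := fun n =>
    le_csSup ⟨(z 0).2, by rintro _ ⟨m, rfl⟩; exact hle m 0⟩ ⟨n, rfl⟩
  have hcv : ∀ n, sSup (Set.range fun n => (z n).1) ≤ (z n).2 := fun n =>
    csSup_le (Set.range_nonempty _) (by rintro _ ⟨m, rfl⟩; exact hle m n)
  set c := sSup (Set.range fun n => (z n).1)
  have hcx : x ≤ c := (hinv 0).1.trans (huc 0)
  have hcy : c ≤ y := (hcv 0).trans (hinv 0).2.2.1
  have hcI : c ∈ openInterval a b :=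
    ⟨hax.mono (sub_le_sub_right hcx a), hyb.mono (sub_le_sub_left hcy b)⟩
  rw [← sub_nonpos]
  refine (hd c hcI).nonpos_of_forall_le hf (sub_nonneg.2 hxy) (fun n => hax'.trans (hinv n).1)
    (fun n => (hinv n).2.2.1.trans hyb') huc hcv (fun n => (hinv n).2.2.2.1) fun n => ?_
  obtain ⟨-, -, -, h4, h5⟩ := hinv n
  linear_combination h5 + hM c ⟨hcx, hcy⟩ - 2 ^ n * M * h4 -
    (y - x) * M * two_pow_mul_half_pow E n

/-- The mean value inequality. On the band of `p`, the carrier of `y - x`, the interval `[x, y]` is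
shrunk slightly; on the complementary band, where `x = y`, it is replaced by the midpoint of `[a, b]`.
The resulting interval lies in `(a, b)`, and continuity recovers the inequality for `[x, y]`. -/
theorem sub_le_mul_of_hasOrderDerivAt (hab : WayLT a b)
    (hf : LocallyBandPreservingOn f (Set.Icc a b)) {f' : E → E}
    (hf' : LocallyBandPreservingOn f' (Set.Icc a b)) (hfc : OrderContinuousOn f (Set.Icc a b))
    (hd : ∀ c ∈ openInterval a b, HasOrderDerivAt f (Set.Icc a b) (f' c) c) {x y M : E}
    (hax : a ≤ x) (hxy : x ≤ y) (hyb : y ≤ b) (hM : ∀ c ∈ Set.Icc x y, f' c ≤ M) :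
    f y - f x ≤ (y - x) * M := by
  have hl : 0 ≤ y - x := sub_nonneg.2 hxy
  have hab' := hab.1
  have hh := half_add_half E
  obtain ⟨p, hp, hpl, hpv⟩ := exists_carrier hl
  have hp0 := IsIdempotentElem.nonneg_of_isFAlgebra hp
  have hq0 := IsIdempotentElem.nonneg_of_isFAlgebra hp.one_sub
  have hp1 := IsIdempotentElem.le_one_of_isFAlgebra hp
  have hxI : x ∈ Set.Icc a b := ⟨hax, hxy.trans hyb⟩
  have hyI : y ∈ Set.Icc a b := ⟨hax.trans hxy, hyb⟩
  have hpow : ∀ n, half E ^ n = half E ^ (n + 1) + half E ^ (n + 1) := fun n => by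
    rw [pow_succ]; linear_combination -half E ^ n * hh
  have hinner : ∀ n : ℕ, 0 ≤ half E ^ (n + 1) * (y - x) ∧
      half E ^ (n + 1) * (y - x) ≤ half E ^ n * (y - x) ∧ half E ^ n * (y - x) ≤ y - x := fun n =>
    ⟨mul_nonneg (half_pow_nonneg E _) hl,
      mul_le_mul_of_nonneg_right (half_pow_antitone n.le_succ) hl,
      mul_le_of_le_one_left hl (pow_le_one₀ (half_nonneg E) (half_le_one E))⟩
  -- the endpoints of the shrunk interval, before gluing
  let X : ℕ → E := fun n => x + half E ^ (n + 1) * (y - x)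
  let Y : ℕ → E := fun n => y - half E ^ (n + 1) * (y - x)
  have hXx : ∀ n, x ≤ X n := fun n => le_add_of_nonneg_right (hinner n).1
  have hYy : ∀ n, Y n ≤ y := fun n => sub_le_self _ (hinner n).1
  have hXY : ∀ n, X n ≤ Y n := fun n => by
    simp only [X, Y]
    linear_combination (hinner n).2.2 - (y - x) * hpow n
  have hXI : ∀ n, X n ∈ Set.Icc a b := fun n =>
    ⟨hax.trans (hXx n), (hXY n).trans ((hYy n).trans hyb)⟩
  have hYI : ∀ n, Y n ∈ Set.Icc a b := fun n =>
    ⟨hax.trans ((hXx n).trans (hXY n)), (hYy n).trans hyb⟩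
  have hmid : half E * (a + b) ∈ Set.Icc a b := by
    have h := mul_nonneg (half_nonneg E) hab'
    exact ⟨by linear_combination h - a * hh, by linear_combination h + b * hh⟩
  -- a common lower bound for the distances of the shrunk interval to `a` and to `b`
  have hunit : ∀ n : ℕ, IsWeakOrderUnit
      (half E ^ (n + 1) * (y - x) + (1 - p) * (half E * (b - a))) := fun n => by
    refine isWeakOrderUnit_iff.2 ⟨add_nonneg (hinner n).1
      (mul_nonneg hq0 (mul_nonneg (half_nonneg E) hab')), fun z hz => ?_⟩
    have h1 : (y - x) * z = 0 := by
      linear_combination 2 ^ (n + 1) * p * hz - z * (y - x) * p * two_pow_mul_half_pow E (n + 1) +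
        2 ^ (n + 1) * z * half E * (b - a) * hp.eq - z * hpl
    have h2 := (isWeakOrderUnit_iff.1 ((isWeakOrderUnit_half E).mul hab)).2 ((1 - p) * z) (by
      linear_combination (1 - p) * hz + z * half E ^ (n + 1) * hpl -
        z * half E * (b - a) * hp.eq)
    linear_combination hpv z h1 + h2
  have hineq : ∀ n, p * (f (Y n) - f (X n)) ≤ (y - x) * M + half E ^ n * ((y - x) * |M|) := by
    intro n
    have hIcc : ∀ {z}, z ∈ Set.Icc a b → p * z + (1 - p) * (half E * (a + b)) ∈ Set.Icc a b :=
      fun hz => mul_add_one_sub_mul_mem_Icc hp (mul_le_mul_of_nonneg_left hz.1 hp0)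
        (mul_le_mul_of_nonneg_left hz.2 hp0) hmid
    have hX' := hIcc (hXI n)
    have hY' := hIcc (hYI n)
    have hlen : p * Y n + (1 - p) * (half E * (a + b)) - (p * X n + (1 - p) * (half E * (a + b))) =
        (1 - half E ^ n) * (y - x) := by
      simp only [X, Y]
      linear_combination (1 - 2 * half E ^ (n + 1)) * hpl + (y - x) * hpow n
    have hle : p * X n + (1 - p) * (half E * (a + b)) ≤ p * Y n + (1 - p) * (half E * (a + b)) :=
      add_le_add_left (mul_le_mul_of_nonneg_left (hXY n) hp0) _
    have h1 := sub_le_mul_of_wayLT hf hd (M := M)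
      ((hunit n).mono (by
        simp only [X]
        linear_combination mul_le_mul_of_nonneg_left hax hp0 - half E ^ (n + 1) * hpl +
          (p - 1) * a * hh))
      hle
      ((hunit n).mono (by
        simp only [Y]
        linear_combination mul_le_mul_of_nonneg_left hyb hp0 - half E ^ (n + 1) * hpl +
          (1 - p) * b * hh))
      (fun c hc => by
        have hcI : c ∈ Set.Icc a b := ⟨hX'.1.trans hc.1, hc.2.trans hY'.2⟩
        have hcx := mul_le_mul_of_nonneg_left hc.1 hp0
        have hcy := mul_le_mul_of_nonneg_left hc.2 hp0
        rw [mul_glue hp] at hcx hcy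
        have hc' : p * c + (1 - p) * x ∈ Set.Icc x y := mul_add_one_sub_mul_mem_Icc hp
          ((mul_le_mul_of_nonneg_left (hXx n) hp0).trans hcx)
          (hcy.trans (mul_le_mul_of_nonneg_left (hYy n) hp0)) ⟨le_rfl, hxy⟩
        have h2 := hf'.mul_eq hp ⟨hax.trans hc'.1, hc'.2.trans hyb⟩ hcI (mul_glue hp c x)
        have h3 := mul_le_mul_of_nonneg_left (hM _ hc') hl
        have h4 : (y - x) * f' c = (y - x) * f' (p * c + (1 - p) * x) := by
          linear_combination (f' (p * c + (1 - p) * x) - f' c) * hpl - (y - x) * h2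
        rw [hlen, mul_assoc, mul_assoc, h4]
        exact mul_le_mul_of_nonneg_left h3 (sub_nonneg.2
          (pow_le_one₀ (half_nonneg E) (half_le_one E))))
    have h2 := mul_le_mul_of_nonneg_left h1 hp0
    rw [hlen] at h2
    have e1 := hf.mul_eq hp hX' (hXI n) (mul_glue hp _ _)
    have e2 := hf.mul_eq hp hY' (hYI n) (mul_glue hp _ _)
    have h3 := mul_le_mul_of_nonneg_left (neg_le_abs M) (mul_nonneg (half_pow_nonneg E n) hl)
    linear_combination h2 - e2 + e1 + h3 + (1 - half E ^ n) * M * hpl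
  have hdist : ∀ n, |X n - x| ≤ half E ^ n * (y - x) ∧ |Y n - y| ≤ half E ^ n * (y - x) := fun n => by
    constructor
    · rw [abs_of_nonneg (sub_nonneg.2 (hXx n)), add_sub_cancel_left]; exact (hinner n).2.1
    · rw [abs_sub_comm, abs_of_nonneg (sub_nonneg.2 (hYy n)), sub_sub_cancel]; exact (hinner n).2.1
  obtain ⟨E₁, hE₁, h₁⟩ := hfc.exists_abs_sub_le hxI hXI hl fun n => (hdist n).1
  obtain ⟨E₂, hE₂, h₂⟩ := hfc.exists_abs_sub_le hyI hYI hl fun n => (hdist n).2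
  have hfp : (1 - p) * f y = (1 - p) * f x :=
    hf.mul_eq hp.one_sub hyI hxI (by linear_combination -hpl)
  rw [← sub_nonpos]
  refine hE₁.2 fun ε₁ hε₁ => ?_
  rw [← sub_nonpos]
  refine hE₂.2 fun ε₂ hε₂ => ?_
  rw [← sub_nonpos]
  refine nonpos_of_forall_le_half_pow_mul (y := (y - x) * |M|) fun k => ?_
  obtain ⟨N₁, hN₁⟩ := h₁ ε₁ hε₁
  obtain ⟨N₂, hN₂⟩ := h₂ ε₂ hε₂
  let n := max k (max N₁ N₂)
  have hn1 := (mul_le_of_le_one_left (abs_nonneg _) hp1).trans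
    (hN₁ n ((le_max_left _ _).trans (le_max_right _ _)))
  have hn2 := (mul_le_of_le_one_left (abs_nonneg _) hp1).trans
    (hN₂ n ((le_max_right _ _).trans (le_max_right _ _)))
  have hnk : half E ^ n * ((y - x) * |M|) ≤ half E ^ k * ((y - x) * |M|) :=
    mul_le_mul_of_nonneg_right (half_pow_antitone (le_max_left _ _))
      (mul_nonneg hl (abs_nonneg M))
  have hx' := mul_le_mul_of_nonneg_left (le_abs_self (f (X n) - f x)) hp0
  have hy' := mul_le_mul_of_nonneg_left (neg_le_abs (f (Y n) - f y)) hp0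
  linear_combination hineq n + hn1 + hn2 + hnk + hx' + hy' + hfp

end Calculus

/-! ### Integration by parts -/

section IntegrationByParts

variable {E : Type u} [CommRing E] [ConditionallyCompleteLattice E] [IsOrderedAddMonoid E]
  [IsFAlgebra E] [Algebra ℝ E] [PosSMulMono ℝ E] {a b : E} {f h₁ h₂ : E → E}

theorem sub_le_upperSum_add_upperSum (hab : WayLT a b)
    (hf : LocallyBandPreservingOn f (Set.Icc a b)) (hfc : OrderContinuousOn f (Set.Icc a b))
    (h₁l : LocallyBandPreservingOn h₁ (Set.Icc a b))
    (h₂l : LocallyBandPreservingOn h₂ (Set.Icc a b)) (h₁b : OrderBoundedOn h₁ (Set.Icc a b))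
    (h₂b : OrderBoundedOn h₂ (Set.Icc a b))
    (hd : ∀ c ∈ openInterval a b, HasOrderDerivAt f (Set.Icc a b) (h₁ c + h₂ c) c)
    (P : Partition a b) : f b - f a ≤ upperSum h₁ P + upperSum h₂ P := by
  have htel := Finset.sum_range_sub (fun i => f (P.pts i)) P.n
  rw [P.pts_last, P.pts_zero] at htel
  rw [← htel, upperSum, upperSum, ← Finset.sum_add_distrib]
  refine Finset.sum_le_sum fun i hi => ?_
  have hi := Finset.mem_range.1 hi
  have hax := P.left_le_pts hi.le
  have hyb := P.pts_le_right hi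
  rw [← add_mul, mul_comm]
  exact sub_le_mul_of_hasOrderDerivAt hab hf (h₁l.add h₂l) hfc hd hax (P.le_succ i hi) hyb
    fun c hc => add_le_add (h₁b.le_sSup hax hyb hc) (h₂b.le_sSup hax hyb hc)

/-- Common refinements turn the bound by upper sums over one partition into a bound by integrals. -/
theorem sub_le_upperIntegral_add_upperIntegral (hab : WayLT a b)
    (hf : LocallyBandPreservingOn f (Set.Icc a b)) (hfc : OrderContinuousOn f (Set.Icc a b))
    (h₁l : LocallyBandPreservingOn h₁ (Set.Icc a b))
    (h₂l : LocallyBandPreservingOn h₂ (Set.Icc a b)) (h₁b : OrderBoundedOn h₁ (Set.Icc a b))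
    (h₂b : OrderBoundedOn h₂ (Set.Icc a b))
    (hd : ∀ c ∈ openInterval a b, HasOrderDerivAt f (Set.Icc a b) (h₁ c + h₂ c) c) :
    f b - f a ≤ upperIntegral h₁ a b + upperIntegral h₂ a b := by
  have hab' : a ≤ b := sub_nonneg.1 hab.1
  rw [← sub_le_iff_le_add]
  refine (isGLB_upperIntegral hab' h₁l h₁b).2 ?_
  rintro _ ⟨P, rfl⟩
  rw [sub_le_comm]
  refine (isGLB_upperIntegral hab' h₂l h₂b).2 ?_
  rintro _ ⟨Q, rfl⟩
  obtain ⟨R, hR⟩ := exists_refinement P Q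
  rw [sub_le_iff_le_add']
  exact (sub_le_upperSum_add_upperSum hab hf hfc h₁l h₂l h₁b h₂b hd R).trans
    (add_le_add (hR h₁ h₁l h₁b).1 (hR h₂ h₂l h₂b).2.1)

theorem lowerIntegral_eq_neg_upperIntegral_neg (hab : a ≤ b)
    (hf : LocallyBandPreservingOn f (Set.Icc a b)) (hb : OrderBoundedOn f (Set.Icc a b)) :
    lowerIntegral f a b = -upperIntegral (fun x => -f x) a b := by
  refine (isLUB_lowerIntegral hab hf hb).unique ?_
  simp only [lowerSum_eq_neg_upperSum_neg hb]
  have h := isGLB_upperIntegral hab hf.neg hb.neg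
  refine ⟨?_, fun w hw => neg_le.1 (h.2 ?_)⟩
  · rintro _ ⟨P, rfl⟩; exact neg_le_neg (h.1 ⟨P, rfl⟩)
  · rintro _ ⟨P, rfl⟩; exact neg_le.1 (hw ⟨P, rfl⟩)

/-- The fundamental theorem of calculus for a derivative given as a sum of two integrable functions. -/
theorem darbouxIntegral_add_eq_sub (hab : WayLT a b)
    (hf : LocallyBandPreservingOn f (Set.Icc a b)) (hfc : OrderContinuousOn f (Set.Icc a b))
    (h₁l : LocallyBandPreservingOn h₁ (Set.Icc a b))
    (h₂l : LocallyBandPreservingOn h₂ (Set.Icc a b)) (h₁i : DarbouxIntegrable h₁ a b)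
    (h₂i : DarbouxIntegrable h₂ a b)
    (hd : ∀ c ∈ openInterval a b, HasOrderDerivAt f (Set.Icc a b) (h₁ c + h₂ c) c) :
    darbouxIntegral h₁ a b + darbouxIntegral h₂ a b = f b - f a := by
  have hab' : a ≤ b := sub_nonneg.1 hab.1
  refine le_antisymm ?_
    (sub_le_upperIntegral_add_upperIntegral hab hf hfc h₁l h₂l h₁i.1 h₂i.1 hd)
  have h := sub_le_upperIntegral_add_upperIntegral hab hf.neg hfc.neg h₁l.neg h₂l.neg h₁i.1.neg
    h₂i.1.neg fun c hc => by
      have := (hd c hc).neg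
      rwa [neg_add] at this
  rw [darbouxIntegral, darbouxIntegral, h₁i.2, h₂i.2,
    lowerIntegral_eq_neg_upperIntegral_neg hab' h₁l h₁i.1,
    lowerIntegral_eq_neg_upperIntegral_neg hab' h₂l h₂i.1]
  linear_combination h

theorem integration_by_parts (hab : WayLT a b) {f g f' g' : E → E}
    (hfl : LocallyBandPreservingOn f (Set.Icc a b))
    (hgl : LocallyBandPreservingOn g (Set.Icc a b))
    (hf'l : LocallyBandPreservingOn f' (Set.Icc a b))
    (hg'l : LocallyBandPreservingOn g' (Set.Icc a b))
    (hfc : OrderContinuousOn f (Set.Icc a b)) (hgc : OrderContinuousOn g (Set.Icc a b))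
    (hfi : DarbouxIntegrable f a b) (hgi : DarbouxIntegrable g a b)
    (hf'i : DarbouxIntegrable f' a b) (hg'i : DarbouxIntegrable g' a b)
    (hfd : ∀ c ∈ openInterval a b, HasOrderDerivAt f (Set.Icc a b) (f' c) c)
    (hgd : ∀ c ∈ openInterval a b, HasOrderDerivAt g (Set.Icc a b) (g' c) c) :
    DarbouxIntegrable (fun x => f x * g' x) a b ∧ DarbouxIntegrable (fun x => f' x * g x) a b ∧
      darbouxIntegral (fun x => f x * g' x) a b =
        f b * g b - f a * g a - darbouxIntegral (fun x => f' x * g x) a b := by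
  have hab' : a ≤ b := sub_nonneg.1 hab.1
  have h₁ := hfi.mul hab' hfl hg'l hg'i
  have h₂ := hf'i.mul hab' hf'l hgl hgi
  obtain ⟨K, -, hK⟩ := hfi.1.exists_abs_le
  obtain ⟨M, hM0, hM⟩ := hgi.1.exists_abs_le
  refine ⟨h₁, h₂, eq_sub_of_add_eq ?_⟩
  exact darbouxIntegral_add_eq_sub hab (hfl.mul hgl) (hgc.mul hfc hK) (hfl.mul hg'l) (hf'l.mul hgl)
    h₁ h₂ fun c hc => (hfd c hc).mul (hgd c hc) hM0 hM

end IntegrationByParts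

end OrderCalculus

end

theorem mainTheorem6 {E : Type*} [Ring E] [ConditionallyCompleteLattice E] [IsOrderedAddMonoid E]
    [Algebra ℝ E] [PosSMulMono ℝ E] [OrderCalculus.IsFAlgebra E]
    (a b : E) (hab : OrderCalculus.WayLT a b)
    (f g f' g' : E → E)
    (hf_lbp : OrderCalculus.LocallyBandPreservingOn f (Set.Icc a b))
    (hg_lbp : OrderCalculus.LocallyBandPreservingOn g (Set.Icc a b))
    (hf'_lbp : OrderCalculus.LocallyBandPreservingOn f' (Set.Icc a b))
    (hg'_lbp : OrderCalculus.LocallyBandPreservingOn g' (Set.Icc a b))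
    (hf_cont : OrderCalculus.OrderContinuousOn f (Set.Icc a b))
    (hg_cont : OrderCalculus.OrderContinuousOn g (Set.Icc a b))
    (hf'_cont : OrderCalculus.OrderContinuousOn f' (Set.Icc a b))
    (hg'_cont : OrderCalculus.OrderContinuousOn g' (Set.Icc a b))
    (hf_int : OrderCalculus.DarbouxIntegrable f a b)
    (hg_int : OrderCalculus.DarbouxIntegrable g a b)
    (hf'_int : OrderCalculus.DarbouxIntegrable f' a b)
    (hg'_int : OrderCalculus.DarbouxIntegrable g' a b)
    (hf_deriv : ∀ c ∈ OrderCalculus.openInterval a b,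
      OrderCalculus.HasOrderDerivAt f (Set.Icc a b) (f' c) c)
    (hg_deriv : ∀ c ∈ OrderCalculus.openInterval a b,
      OrderCalculus.HasOrderDerivAt g (Set.Icc a b) (g' c) c) :
    OrderCalculus.DarbouxIntegrable (fun x => f x * g' x) a b ∧
    OrderCalculus.DarbouxIntegrable (fun x => f' x * g x) a b ∧
    OrderCalculus.darbouxIntegral (fun x => f x * g' x) a b =
      f b * g b - f a * g a - OrderCalculus.darbouxIntegral (fun x => f' x * g x) a b := by
  let _ : CommRing E := OrderCalculus.commRingOfIsFAlgebra E
  exact OrderCalculus.integration_by_parts hab hf_lbp hg_lbp hf'_lbp hg'_lbp hf_cont hg_cont hf_int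
    hg_int hf'_int hg'_int hf_deriv hg_deriv
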